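/- Let $k\ge 1$. For $\varepsilon=(\varepsilon_0,\dots,\varepsilon_{k-1})\in\mathbb{C}^k$ put $P_\varepsilon(x)=x^{k+1}+\varepsilon_{k-1}x^{k-1}+\dots+\varepsilon_1x+\varepsilon_0$. Let $a,\tilde a$ be germs at $0\in\mathbb{C}^k$ of holomorphic functions, and set $$X_\varepsilon=\frac{P_\varepsilon(x)}{1+a(\varepsilon)x^k}\,\frac{\partial}{\partial x},\qquad \tilde X_h=\frac{P_h(z)}{1+\tilde a(h)z^k}\,\frac{\partial}{\partial z}.$$ Let $\Psi:(x,\varepsilon)\mapsto(\varphi_\varepsilon(x),h(\varepsilon))=(z,h)$, with $h(\varepsilon)=(h_0(\varepsilon),\dots,h_{k-1}(\varepsilon))$, be a germ of an analytic change of coordinates at the origin of $\mathbb{C}^{1+k}$ (analytic, fixing the origin, with analytic inverse germ). The following assertions are equivalent. 1. The families $(X_\varepsilon)_\varepsilon$ and $(\tilde X_h)_h$ are conjugate under $\Psi$, that is, for all $(x,\varepsilon)$ near the origin, $$\varphi_\varepsilon'(x)\,\frac{P_\varepsilon(x)}{1+a(\varepsilon)x^k}=\frac{P_{h(\varepsilon)}(\varphi_\varepsilon(x))}{1+\tilde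 a(h(\varepsilon))\,\varphi_\varepsilon(x)^k}.$$ 2. There exist $\lambda\in\mathbb{C}$ with $\lambda^k=1$ and a germ $T$ of a holomorphic function at $0\in\mathbb{C}^k$ (with $T(0)$ not necessarily $0$) such that, for $(x,\varepsilon)$ near the origin, - $\varphi_\varepsilon(x)=\Phi^{T(\varepsilon)}_{\tilde X_{h(\varepsilon)}}(\lambda x)$, where $\Phi^{t}_{Y}$ denotes the flow of the vector field $Y$ at the complex time $t$, i.e. the time-one flow of $tY$; - $\varepsilon_j=\lambda^{j-1}h_j(\varepsilon)$ for $j=0,\dots,k-1$; - $a(\varepsilon)=\tilde a(h(\varepsilon))$. -/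

import Mathlib

open Filter Topology

namespace OneDimFamily

noncomputable section

/-- The polynomial `P_ε(x) = x^(k+1) + ε_(k-1) x^(k-1) + ⋯ + ε_1 x + ε_0`. -/
def P {k : ℕ} (ε : Fin k → ℂ) (x : ℂ) : ℂ :=
  x ^ (k + 1) + ∑ j : Fin k, ε j * x ^ (j : ℕ)

/-- The coefficient of the vector field `P_ε(x) / (1 + c x^k) ∂_x`. -/
def field {k : ℕ} (c : ℂ) (ε : Fin k → ℂ) (x : ℂ) : ℂ :=
  P ε x / (1 + c * x ^ k)

/-- The set on which the vector field `P_ε(x) / (1 + c x^k) ∂_x` is defined. -/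
def fieldDomain (k : ℕ) (c : ℂ) : Set ℂ :=
  {x | 1 + c * x ^ k ≠ 0}

/-- `FlowsTo U f t x y` says that the flow at the complex time `t` of the holomorphic vector
field `f ∂_x` on `U ⊆ ℂ` is defined at `x` and equals `y`. The flow at time `t` is obtained by
following the solution of `dx/dτ = f(x)` along the segment from `0` to `t` in the complex time
plane; with `τ = s t`, `0 ≤ s ≤ 1`, the equation reads `dγ/ds = t f(γ)`. -/
def FlowsTo (U : Set ℂ) (f : ℂ → ℂ) (t x y : ℂ) : Prop :=
  ∃ γ : ℝ → ℂ, γ 0 = x ∧ γ 1 = y ∧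
    ∀ s ∈ Set.Icc (0 : ℝ) 1,
      γ s ∈ U ∧ HasDerivWithinAt γ (t * f (γ s)) (Set.Icc (0 : ℝ) 1) s

/-- `Ψ` represents a germ at the origin of an analytic change of coordinates: it is analytic at
`0`, fixes `0`, and has an inverse germ with the same properties. -/
def IsAnalyticChange {E : Type*} [NormedAddCommGroup E] [NormedSpace ℂ E] (Ψ : E → E) : Prop :=
  AnalyticAt ℂ Ψ 0 ∧ Ψ 0 = 0 ∧
    ∃ Θ : E → E, AnalyticAt ℂ Θ 0 ∧ Θ 0 = 0 ∧
      (∀ᶠ p in 𝓝 (0 : E), Θ (Ψ p) = p) ∧ (∀ᶠ p in 𝓝 (0 : E), Ψ (Θ p) = p)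

/-- The germs at the origin of the families of vector fields `(X_ε ∂_x)` and `(Y_η ∂_z)` are
conjugate under `(x, ε) ↦ (φ_ε(x), h(ε))`: for `(x, ε)` near the origin, the tangent map of `φ_ε`
carries `X_ε` at the point `x` to `Y_(h(ε))` at the point `φ_ε(x)`. -/
def ConjugateUnder {k : ℕ} (X Y : (Fin k → ℂ) → ℂ → ℂ)
    (φ : (Fin k → ℂ) → ℂ → ℂ) (h : (Fin k → ℂ) → (Fin k → ℂ)) : Prop :=
  ∀ᶠ p : ℂ × (Fin k → ℂ) in 𝓝 0,
    deriv (φ p.2) p.1 * X p.2 p.1 = Y (h p.2) (φ p.2 p.1)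

end

end OneDimFamily

namespace OneDimFamily

open Set Metric

open scoped ContDiff

variable {k : ℕ}

/-! From 2 to 1: a vector field is invariant under its own flow (`deriv_mul_eq_of_flowsTo`), and the
family is weighted homogeneous, so that `x ↦ l * x` with `l ^ k = 1` carries `X_ε` to the member
with parameters `l ^ (k + 1 - j) * ε j` and the same `a` (`field_scale`).

From 1 to 2: put `l = φ_0'(0)`. Leading terms at `ε = 0` give `l ^ k = 1`. Dilating the source by a
small `r` and the target by `l * r` makes the conjugacy close to the identity on the closed unit
disc, with small parameters, and it remains to see that such a conjugacy `φ` is a flow map of the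
source field (`exists_flow_of_close`). Near `1` that field is close to `1`, so some small time `t`,
analytic in the data, flows `1` to `φ 1` (`exists_transit_time`); let `ψ` be the flow at time `t`.

Now `φ` and `ψ` solve conjugacy equations from the same source and agree at `1`. Their difference
`u`, with the differences `η` and `β` of the target parameters, satisfies the linearised equation up
to a remainder that is a small multiple of `(u, u', η, β)`. On the unit circle the linearised
equation is invertible with a bound on `u'` as well: `η` and `β` are residues, and `u` is then
determined up to multiples of `x ^ (k + 1)`, the direction of the flow, which `u 1 = 0` excludes. So
any bound on the differences can be halved, and they vanish (`exists_rigidity_radius`). -/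

/-! ### Stability of trajectories and invariance of a field under its flow. -/

/-- A holomorphic function is Lipschitz, at a uniform scale, around the points of a compact set. -/
theorem exists_lipschitz_around_compact {U K : Set ℂ} {f : ℂ → ℂ} (hU : IsOpen U)
    (hK : IsCompact K) (hKU : K ⊆ U) (hf : DifferentiableOn ℂ f U) :
    ∃ L : ℝ, 0 ≤ L ∧ ∃ ρ > 0, ∀ z ∈ K, ∀ w, ‖w - z‖ ≤ ρ → w ∈ U ∧ ‖f w - f z‖ ≤ L * ‖w - z‖ := by
  obtain ⟨ρ, hρ, hsub⟩ := hK.exists_cthickening_subset_open hU hKU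
  have hcomp : IsCompact (Metric.cthickening ρ K) := hK.cthickening
  obtain ⟨L, hL⟩ := hcomp.exists_bound_of_continuousOn
    ((hf.deriv hU).continuousOn.mono hsub)
  refine ⟨max L 0, le_max_right _ _, ρ, hρ, fun z hz w hw => ?_⟩
  have hball : Metric.closedBall z ρ ⊆ Metric.cthickening ρ K :=
    Metric.closedBall_subset_cthickening hz ρ
  have hwB : w ∈ Metric.closedBall z ρ := by simpa [dist_eq_norm] using hw
  refine ⟨hsub (hball hwB), ?_⟩
  refine Convex.norm_image_sub_le_of_norm_deriv_le (s := Metric.closedBall z ρ)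
    (fun x hx => ?_) (fun x hx => ?_) (convex_closedBall z ρ)
    (Metric.mem_closedBall_self hρ.le) hwB
  · exact hf.differentiableAt (hU.mem_nhds (hsub (hball hx)))
  · exact (hL x (hball hx)).trans (le_max_left _ _)

/-- Second order Taylor estimate, uniform around the points of a compact set. -/
theorem exists_taylor_around_compact {U K : Set ℂ} {f : ℂ → ℂ} (hU : IsOpen U)
    (hK : IsCompact K) (hKU : K ⊆ U) (hf : DifferentiableOn ℂ f U) :
    ∃ L : ℝ, 0 ≤ L ∧ ∃ ρ > 0, ∀ z ∈ K, ∀ w, ‖w‖ ≤ ρ →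
      ‖f (z + w) - f z - deriv f z * w‖ ≤ L * ‖w‖ ^ 2 := by
  obtain ⟨L, hL, ρ, hρ, h⟩ := exists_lipschitz_around_compact hU hK hKU (hf.deriv hU)
  refine ⟨L, hL, ρ, hρ, fun z hz w hw => ?_⟩
  have key := Convex.norm_image_sub_le_of_norm_hasDerivWithin_le (𝕜 := ℂ)
    (f := fun y => f y - deriv f z * y) (f' := fun y => deriv f y - deriv f z)
    (s := Metric.closedBall z ‖w‖) (x := z) (y := z + w) (C := L * ‖w‖)
    (fun y hy => ?_) (fun y hy => ?_) (convex_closedBall z _)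
    (Metric.mem_closedBall_self (norm_nonneg _)) (by simp)
  · have e : f (z + w) - deriv f z * (z + w) - (f z - deriv f z * z)
        = f (z + w) - f z - deriv f z * w := by ring
    rw [e] at key
    simpa [pow_two, mul_assoc] using key
  · have hy' : ‖y - z‖ ≤ ‖w‖ := by simpa [dist_eq_norm] using hy
    have hyU := (h z hz y (hy'.trans hw)).1
    have := (hf.differentiableAt (hU.mem_nhds hyU)).hasDerivAt
    have h2 := this.sub ((hasDerivAt_id y).const_mul (deriv f z))
    rw [mul_one] at h2
    exact h2.hasDerivWithinAt
  · have hy' : ‖y - z‖ ≤ ‖w‖ := by simpa [dist_eq_norm] using hy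
    exact (h z hz y (hy'.trans hw)).2.trans (mul_le_mul_of_nonneg_left hy' hL)

/-- Trajectories of a holomorphic vector field stay close to approximate trajectories. -/
theorem exists_dist_le_of_approx_trajectory {U K : Set ℂ} {f : ℂ → ℂ} (hU : IsOpen U)
    (hK : IsCompact K) (hKU : K ⊆ U) (hf : DifferentiableOn ℂ f U) (t : ℂ) :
    ∃ C > 0, ∃ e₀ > 0, ∀ e, 0 < e → e ≤ e₀ → ∀ (γ η η' : ℝ → ℂ),
      (∀ s ∈ Icc (0 : ℝ) 1, HasDerivWithinAt γ (t * f (γ s)) (Icc (0 : ℝ) 1) s) →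
      (∀ s ∈ Icc (0 : ℝ) 1, η s ∈ K ∧ HasDerivWithinAt η (η' s) (Icc (0 : ℝ) 1) s ∧
        ‖η' s - t * f (η s)‖ ≤ e) →
      ‖γ 0 - η 0‖ ≤ e → ∀ s ∈ Icc (0 : ℝ) 1, ‖γ s - η s‖ ≤ C * e := by
  obtain ⟨L, hL, ρ, hρ, h⟩ := exists_lipschitz_around_compact hU hK hKU hf
  -- When the distance meets the barrier `B = e * exp (M * s)`, its growth is at most `‖t‖ * L * B +
  -- e ≤ (‖t‖ * L + 1) * B`; one more unit makes the comparison strict. The threshold `ρ / exp M`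
  -- keeps `B ≤ ρ`, where the Lipschitz bound holds, so `γ` needs no a priori confinement.
  set M : ℝ := ‖t‖ * L + 2 with hM
  have hM0 : 0 < M := by positivity
  refine ⟨Real.exp M, Real.exp_pos _, ρ / Real.exp M, by positivity, ?_⟩
  intro e he hee γ η η' hγ hη h0
  have hmono : ∀ s ∈ Icc (0 : ℝ) 1, e * Real.exp (M * s) ≤ Real.exp M * e := by
    intro s hs
    rw [mul_comm]
    refine mul_le_mul_of_nonneg_right (Real.exp_le_exp.2 ?_) he.le
    nlinarith [hs.2]
  have hIci : ∀ {F : ℝ → ℂ} {F' : ℂ} {s : ℝ}, s ∈ Ico (0 : ℝ) 1 →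
      HasDerivWithinAt F F' (Icc (0 : ℝ) 1) s → HasDerivWithinAt F F' (Ici s) s := by
    intro F F' s hs hF
    refine (hF.mono (Icc_subset_Icc_left hs.1)).mono_of_mem_nhdsWithin ?_
    exact Icc_mem_nhdsGE_of_mem ⟨le_rfl, hs.2⟩
  have key := image_norm_le_of_norm_deriv_right_lt_deriv_boundary (a := 0) (b := 1)
    (f := fun s => γ s - η s) (f' := fun s => t * f (γ s) - η' s)
    (B := fun s => e * Real.exp (M * s)) (B' := fun s => e * (Real.exp (M * s) * M))
    ?_ ?_ ?_ ?_ ?_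
  · exact fun s hs => (key hs).trans (hmono s hs)
  · exact fun s hs => ((hγ s hs).sub (hη s hs).2.1).continuousWithinAt
  · intro s hs
    exact hIci hs ((hγ s ⟨hs.1, hs.2.le⟩).sub (hη s ⟨hs.1, hs.2.le⟩).2.1)
  · simpa using h0
  · intro s
    have := ((hasDerivAt_id s).const_mul M).exp.const_mul e
    simpa using this
  · intro s hs hB
    have hs' : s ∈ Icc (0 : ℝ) 1 := ⟨hs.1, hs.2.le⟩
    obtain ⟨hKs, -, hds⟩ := hη s hs'
    have hexp : 1 ≤ Real.exp (M * s) := Real.one_le_exp (by have := hs.1; positivity)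
    have hBρ : ‖γ s - η s‖ ≤ ρ := by
      rw [hB]
      refine (hmono s hs').trans ?_
      calc Real.exp M * e ≤ Real.exp M * (ρ / Real.exp M) := by gcongr
        _ = ρ := by field_simp
    have hlip := (h _ hKs _ hBρ).2
    have e1 : t * f (γ s) - η' s = t * (f (γ s) - f (η s)) - (η' s - t * f (η s)) := by ring
    have h1 : ‖t * f (γ s) - η' s‖ ≤ ‖t‖ * (L * (e * Real.exp (M * s))) + e := by
      rw [e1]
      refine (norm_sub_le _ _).trans (add_le_add ?_ hds)
      rw [norm_mul]
      rw [hB] at hlip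
      gcongr
    refine h1.trans_lt ?_
    have h2 : e ≤ e * Real.exp (M * s) := le_mul_of_one_le_right he.le hexp
    have h3 : 0 < e * Real.exp (M * s) := by positivity
    rw [hM]
    nlinarith

/-- An exact trajectory is an approximate one for every error `e`; let `e` tend to `0`. -/
theorem FlowsTo.unique {U : Set ℂ} {f : ℂ → ℂ} (hU : IsOpen U) (hf : DifferentiableOn ℂ f U)
    {t x y y' : ℂ} (h : FlowsTo U f t x y) (h' : FlowsTo U f t x y') : y = y' := by
  obtain ⟨γ, h0, h1, hγ⟩ := h
  obtain ⟨η, h0', h1', hη⟩ := h'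
  have hK : IsCompact (η '' Icc (0 : ℝ) 1) :=
    isCompact_Icc.image_of_continuousOn fun s hs => (hη s hs).2.continuousWithinAt
  obtain ⟨C, hC, e₀, he₀, H⟩ := exists_dist_le_of_approx_trajectory hU hK
    (by rintro _ ⟨s, hs, rfl⟩; exact (hη s hs).1) hf t
  have hle : ∀ e, 0 < e → e ≤ e₀ → ‖y - y'‖ ≤ C * e := by
    intro e he hee
    rw [← h1, ← h1']
    refine H e he hee γ η (fun s => t * f (η s)) (fun s hs => (hγ s hs).2)
      (fun s hs => ⟨mem_image_of_mem _ hs, (hη s hs).2, by simpa using he.le⟩)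
      (by simpa [h0, h0'] using he.le) 1 (by simp)
  have hlim : Tendsto (fun e : ℝ => C * e) (𝓝[>] 0) (𝓝 0) := by
    have : Tendsto (fun e : ℝ => C * e) (𝓝 0) (𝓝 (C * 0)) := by
      exact (continuous_const.mul continuous_id).tendsto 0
    simpa using this.mono_left nhdsWithin_le_nhds
  have : ‖y - y'‖ ≤ 0 := by
    refine ge_of_tendsto hlim ?_
    filter_upwards [Ioc_mem_nhdsGT he₀] with e he using hle e he.1 he.2
  exact sub_eq_zero.1 (norm_le_zero_iff.1 this)

/-- The flow of a vector field preserves that vector field. -/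
theorem deriv_mul_eq_of_flowsTo {U : Set ℂ} {f g : ℂ → ℂ} (hU : IsOpen U)
    (hf : DifferentiableOn ℂ f U) {t x₀ : ℂ} (hg : DifferentiableAt ℂ g x₀)
    (hfl : ∀ᶠ x in 𝓝 x₀, FlowsTo U f t x (g x)) : deriv g x₀ * f x₀ = f (g x₀) := by
  obtain ⟨γ, h0, h1, hγ⟩ := hfl.self_of_nhds
  have hγc : ContinuousOn γ (Icc (0 : ℝ) 1) := fun s hs => (hγ s hs).2.continuousWithinAt
  set K₀ : Set ℂ := γ '' Icc (0 : ℝ) 1 with hK₀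
  have hKc : IsCompact K₀ := isCompact_Icc.image_of_continuousOn hγc
  have hKU : K₀ ⊆ U := by rintro _ ⟨s, hs, rfl⟩; exact (hγ s hs).1
  obtain ⟨r, hr, hsub⟩ := hKc.exists_cthickening_subset_open hU hKU
  obtain ⟨C, hC, e₀, he₀, H⟩ := exists_dist_le_of_approx_trajectory hU
    (hKc.cthickening (r := r)) hsub hf t
  obtain ⟨L, hL, ρ, hρ, hT⟩ := exists_taylor_around_compact hU hKc hKU hf
  obtain ⟨M, hM⟩ := hKc.exists_bound_of_continuousOn (hf.continuousOn.mono hKU)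
  have hM0 : 0 ≤ M := (norm_nonneg _).trans (hM (γ 0) ⟨0, by simp, rfl⟩)
  -- Taylor constant of the defect below; the `+ 1` keeps the error `A * ‖δ‖ ^ 2` positive.
  set A : ℝ := ‖t‖ * (L * M ^ 2) + 1 with hA
  have hA0 : 0 < A := by positivity
  -- Along `γ`, the path `f ∘ γ` solves the linearised equation, so `γ + δ * f ∘ γ` is a trajectory
  -- up to `O(δ ^ 2)`. It starts at `x₀ + δ * f x₀` and ends at `g x₀ + δ * f (g x₀)`, hence stays
  -- close to the true trajectory ending at `g (x₀ + δ * f x₀)`.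
  have hmain : ∀ᶠ δ : ℂ in 𝓝[≠] 0,
      ‖g (x₀ + δ * f x₀) - g x₀ - δ * f (g x₀)‖ ≤ C * A * ‖δ‖ ^ 2 := by
    have hc1 : Tendsto (fun δ : ℂ => x₀ + δ * f x₀) (𝓝 0) (𝓝 x₀) := by
      have : Continuous (fun δ : ℂ => x₀ + δ * f x₀) := by fun_prop
      simpa using this.tendsto 0
    have hc2 : ∀ᶠ δ : ℂ in 𝓝 0, ‖δ‖ * M ≤ ρ ∧ ‖δ‖ * M ≤ r ∧ A * ‖δ‖ ^ 2 ≤ e₀ := by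
      have c1 : ∀ᶠ δ : ℂ in 𝓝 0, ‖δ‖ * M < ρ :=
        (by fun_prop : Continuous fun δ : ℂ => ‖δ‖ * M).continuousAt.eventually_lt
          continuousAt_const (by simpa using hρ)
      have c2 : ∀ᶠ δ : ℂ in 𝓝 0, ‖δ‖ * M < r :=
        (by fun_prop : Continuous fun δ : ℂ => ‖δ‖ * M).continuousAt.eventually_lt
          continuousAt_const (by simpa using hr)
      have c3 : ∀ᶠ δ : ℂ in 𝓝 0, A * ‖δ‖ ^ 2 < e₀ :=
        (by fun_prop : Continuous fun δ : ℂ => A * ‖δ‖ ^ 2).continuousAt.eventually_lt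
          continuousAt_const (by simpa using he₀)
      filter_upwards [c1, c2, c3] with δ d1 d2 d3 using ⟨d1.le, d2.le, d3.le⟩
    filter_upwards [nhdsWithin_le_nhds (hc1.eventually hfl), nhdsWithin_le_nhds hc2,
      self_mem_nhdsWithin] with δ hδ hδ2 hδ0
    obtain ⟨hδρ, hδr, hδe⟩ := hδ2
    have hδpos : 0 < ‖δ‖ := norm_pos_iff.2 hδ0
    obtain ⟨γ', h0', h1', hγ'⟩ := hδ
    have hsmall : ∀ s ∈ Icc (0 : ℝ) 1, ‖δ * f (γ s)‖ ≤ ‖δ‖ * M := by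
      intro s hs
      rw [norm_mul]
      exact mul_le_mul_of_nonneg_left (hM _ (mem_image_of_mem _ hs)) (norm_nonneg _)
    have := H (A * ‖δ‖ ^ 2) (by positivity) hδe γ' (fun s => γ s + δ * f (γ s))
      (fun s => t * f (γ s) + δ * (deriv f (γ s) * (t * f (γ s))))
      (fun s hs => (hγ' s hs).2) ?_ ?_ 1 (by simp)
    · simp only [h1', h1] at this
      rw [← sub_sub] at this
      linarith
    · intro s hs
      refine ⟨?_, ?_, ?_⟩
      · refine Metric.mem_cthickening_of_dist_le _ (γ s) _ _ (mem_image_of_mem _ hs) ?_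
        rw [dist_eq_norm, add_sub_cancel_left]
        exact (hsmall s hs).trans hδr
      · have hd := (hf.differentiableAt (hU.mem_nhds (hγ s hs).1)).hasDerivAt
        exact (hγ s hs).2.add ((hd.comp_hasDerivWithinAt s (hγ s hs).2).const_mul δ)
      · have hTs := hT (γ s) (mem_image_of_mem _ hs) (δ * f (γ s)) ((hsmall s hs).trans hδρ)
        have e1 : t * f (γ s) + δ * (deriv f (γ s) * (t * f (γ s)))
            - t * f (γ s + δ * f (γ s)) = -(t * (f (γ s + δ * f (γ s)) - f (γ s)
              - deriv f (γ s) * (δ * f (γ s)))) := by ring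
        rw [e1, norm_neg, norm_mul]
        have h2 : ‖δ * f (γ s)‖ ^ 2 ≤ (‖δ‖ * M) ^ 2 :=
          pow_le_pow_left₀ (norm_nonneg _) (hsmall s hs) 2
        have h3 : ‖t‖ * (L * ‖δ * f (γ s)‖ ^ 2) ≤ ‖t‖ * (L * (‖δ‖ * M) ^ 2) := by gcongr
        have h4 := mul_le_mul_of_nonneg_left hTs (norm_nonneg t)
        have h5 : 0 ≤ ‖δ‖ ^ 2 := by positivity
        calc _ ≤ _ := h4.trans h3
          _ ≤ A * ‖δ‖ ^ 2 := by rw [hA]; nlinarith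
    · simp only [h0', h0]
      rw [sub_self, norm_zero]; positivity
  have hder : HasDerivAt (fun δ : ℂ => g (x₀ + δ * f x₀)) (deriv g x₀ * f x₀) 0 := by
    have h1 : HasDerivAt (fun δ : ℂ => x₀ + δ * f x₀) (f x₀) 0 := by
      simpa using ((hasDerivAt_id (0 : ℂ)).mul_const (f x₀)).const_add x₀
    have h2 : HasDerivAt g (deriv g x₀) (x₀ + 0 * f x₀) := by simpa using hg.hasDerivAt
    exact h2.comp (0 : ℂ) h1
  have hder' : HasDerivAt (fun δ : ℂ => g (x₀ + δ * f x₀)) (f (g x₀)) 0 := by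
    rw [hasDerivAt_iff_isLittleO]
    have hO : (fun δ : ℂ => g (x₀ + δ * f x₀) - g x₀ - δ * f (g x₀)) =O[𝓝 0]
        fun δ : ℂ => ‖δ‖ ^ 2 := by
      refine Asymptotics.IsBigO.of_bound (C * A) ?_
      rw [← nhdsNE_sup_pure, eventually_sup]
      refine ⟨?_, by simp⟩
      filter_upwards [hmain] with δ hδ
      simpa using hδ
    have ho : (fun δ : ℂ => ‖δ‖ ^ 2) =o[𝓝 0] fun δ : ℂ => δ :=
      Asymptotics.isLittleO_norm_pow_id one_lt_two
    simpa using hO.trans_isLittleO ho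
  exact hder.unique hder'

/-! ### The family, its dilations, and flows as conjugacies. -/

theorem continuous_P : Continuous fun q : (Fin k → ℂ) × ℂ => P q.1 q.2 := by
  unfold P
  fun_prop

theorem differentiable_P (ε : Fin k → ℂ) : Differentiable ℂ (P ε) := by
  unfold P
  fun_prop

theorem P_zero (x : ℂ) : P (0 : Fin k → ℂ) x = x ^ (k + 1) := by simp [P]

theorem isOpen_fieldDomain (k : ℕ) (c : ℂ) : IsOpen (fieldDomain k c) :=
  isOpen_ne_fun (by fun_prop) continuous_const

theorem differentiableOn_field (c : ℂ) (ε : Fin k → ℂ) :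
    DifferentiableOn ℂ (field c ε) (fieldDomain k c) := by
  intro x hx
  have h1 : DifferentiableAt ℂ (fun x : ℂ => 1 + c * x ^ k) x := by fun_prop
  exact ((differentiable_P ε).differentiableAt.fun_div h1 hx).differentiableWithinAt

/-- With weight `1` for `x` and `k + 1 - j` for `ε j`, the polynomial is homogeneous of degree `k +
1`. -/
theorem P_scale (s : ℂ) (ε : Fin k → ℂ) (x : ℂ) :
    P (fun j => s ^ (k + 1 - (j : ℕ)) * ε j) (s * x) = s ^ (k + 1) * P ε x := by
  unfold P
  rw [mul_add, mul_pow, Finset.mul_sum]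
  congr 1
  refine Finset.sum_congr rfl fun j _ => ?_
  have : s ^ (k + 1) = s ^ (k + 1 - (j : ℕ)) * s ^ (j : ℕ) := by
    rw [← pow_add]; congr 1; have := j.2; omega
  rw [this, mul_pow]; ring

theorem field_scale (s c : ℂ) (ε : Fin k → ℂ) (x : ℂ) :
    field c (fun j => s ^ (k + 1 - (j : ℕ)) * ε j) (s * x)
      = s ^ (k + 1) * field (c * s ^ k) ε x := by
  unfold field
  rw [P_scale, mul_pow, mul_div_assoc, mul_assoc c]

/-- The dilation by `s` pushes the field to `s ^ (-k)` times the field with dilated parameters; the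
factor is absorbed in the time. -/
theorem FlowsTo.scale {s : ℂ} (hs : s ≠ 0) {c T x y : ℂ} {ε : Fin k → ℂ}
    (h : FlowsTo (fieldDomain k (c * s ^ k)) (field (c * s ^ k) ε) T x y) :
    FlowsTo (fieldDomain k c) (field c fun j => s ^ (k + 1 - (j : ℕ)) * ε j)
      (T / s ^ k) (s * x) (s * y) := by
  obtain ⟨γ, h0, h1, hγ⟩ := h
  refine ⟨fun u => s * γ u, by simp [h0], by simp [h1], fun u hu => ⟨?_, ?_⟩⟩
  · have : 1 + c * s ^ k * γ u ^ k ≠ 0 := (hγ u hu).1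
    change 1 + c * (s * γ u) ^ k ≠ 0
    rwa [mul_pow, ← mul_assoc]
  · rw [field_scale]
    have e : T / s ^ k * (s ^ (k + 1) * field (c * s ^ k) ε (γ u))
        = s * (T * field (c * s ^ k) ε (γ u)) := by
      rw [pow_succ]
      field_simp
    rw [e]
    exact (hγ u hu).2.const_mul s

theorem FlowsTo.left_mem {U : Set ℂ} {f : ℂ → ℂ} {t x y : ℂ} (h : FlowsTo U f t x y) : x ∈ U := by
  obtain ⟨γ, h0, h1, hγ⟩ := h
  exact h0 ▸ (hγ 0 (by simp)).1

theorem FlowsTo.right_mem {U : Set ℂ} {f : ℂ → ℂ} {t x y : ℂ} (h : FlowsTo U f t x y) :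
    y ∈ U := by
  obtain ⟨γ, h0, h1, hγ⟩ := h
  exact h1 ▸ (hγ 1 (by simp)).1

/-- Slices of a function analytic at the origin of a product are differentiable near the
origin. -/
theorem eventually_differentiableAt_slice {φ : (Fin k → ℂ) → ℂ → ℂ}
    (hφ : AnalyticAt ℂ (fun p : ℂ × (Fin k → ℂ) => φ p.2 p.1) 0) :
    ∀ᶠ p : ℂ × (Fin k → ℂ) in 𝓝 0, DifferentiableAt ℂ (φ p.2) p.1 := by
  filter_upwards [hφ.eventually_analyticAt] with p hp
  have h1 : DifferentiableAt ℂ (fun x : ℂ => (x, p.2)) p.1 := by fun_prop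
  exact DifferentiableAt.comp (f := fun x : ℂ => (x, p.2)) p.1 hp.differentiableAt h1

/-- Reconciles the weight `k + 1 - j` with the exponent `j - 1` of the main theorem, which is `-1`
for `j = 0`: they add up to `k`. -/
theorem zpow_sub_one_mul_pow {l : ℂ} (hl : l ≠ 0) (hlk : l ^ k = 1) (j : Fin k) :
    l ^ (k + 1 - (j : ℕ)) * l ^ (((j : ℕ) : ℤ) - 1) = 1 := by
  have hj : (j : ℕ) ≤ k + 1 := by have := j.2; omega
  rw [← zpow_natCast l (k + 1 - (j : ℕ)), ← zpow_add₀ hl, Nat.cast_sub hj]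
  have : (((k + 1 : ℕ) : ℤ) - ((j : ℕ) : ℤ) + (((j : ℕ) : ℤ) - 1)) = (k : ℤ) := by push_cast; ring
  rw [this, zpow_natCast, hlk]

theorem conjugateUnder_of_flowsTo (hk : 1 ≤ k) {a a' T : (Fin k → ℂ) → ℂ}
    {φ : (Fin k → ℂ) → ℂ → ℂ} {h : (Fin k → ℂ) → (Fin k → ℂ)} {l : ℂ} (hlk : l ^ k = 1)
    (hφ : AnalyticAt ℂ (fun p : ℂ × (Fin k → ℂ) => φ p.2 p.1) 0)
    (hfl : ∀ᶠ p : ℂ × (Fin k → ℂ) in 𝓝 0, FlowsTo (fieldDomain k (a' (h p.2)))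
      (field (a' (h p.2)) (h p.2)) (T p.2) (l * p.1) (φ p.2 p.1))
    (hε : ∀ᶠ ε : Fin k → ℂ in 𝓝 0, ∀ j : Fin k, ε j = l ^ ((j : ℤ) - 1) * h ε j)
    (ha : ∀ᶠ ε : Fin k → ℂ in 𝓝 0, a ε = a' (h ε)) :
    ConjugateUnder (fun ε => field (a ε) ε) (fun η => field (a' η) η) φ h := by
  have hl : l ≠ 0 := by
    rintro rfl
    rw [zero_pow (by omega)] at hlk
    exact zero_ne_one hlk
  have hsnd : Tendsto (Prod.snd : ℂ × (Fin k → ℂ) → _) (𝓝 0) (𝓝 0) :=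
    continuous_snd.tendsto' _ _ rfl
  unfold ConjugateUnder
  filter_upwards [hfl.eventually_nhds, eventually_differentiableAt_slice hφ,
    hsnd.eventually hε, hsnd.eventually ha] with p hp hd hεp hap
  obtain ⟨x, ε⟩ := p
  simp only at hp hd hεp hap ⊢
  -- The flow starts at `l * x`, so the invariance is applied to `z ↦ φ ε (l⁻¹ * z)` at that point.
  have hslice : ∀ᶠ z in 𝓝 (l * x), FlowsTo (fieldDomain k (a' (h ε)))
      (field (a' (h ε)) (h ε)) (T ε) z (φ ε (l⁻¹ * z)) := by
    have hc : Tendsto (fun z : ℂ => (l⁻¹ * z, ε)) (𝓝 (l * x)) (𝓝 (x, ε)) := by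
      refine Continuous.tendsto' (by fun_prop) _ _ ?_
      rw [inv_mul_cancel_left₀ hl]
    filter_upwards [hc.eventually hp] with z hz
    simpa [mul_inv_cancel_left₀ hl] using hz
  have hd1 : HasDerivAt (fun z => φ ε (l⁻¹ * z)) (deriv (φ ε) x * l⁻¹) (l * x) := by
    have h1 : HasDerivAt (fun z : ℂ => l⁻¹ * z) l⁻¹ (l * x) := by
      simpa using (hasDerivAt_id (l * x)).const_mul l⁻¹
    have h2 : HasDerivAt (φ ε) (deriv (φ ε) x) (l⁻¹ * (l * x)) := by
      rw [inv_mul_cancel_left₀ hl]; exact hd.hasDerivAt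
    exact h2.comp (l * x) h1
  have key := deriv_mul_eq_of_flowsTo (isOpen_fieldDomain k _) (differentiableOn_field _ _)
    hd1.differentiableAt hslice
  rw [hd1.deriv] at key
  have hh : h ε = fun j : Fin k => l ^ (k + 1 - (j : ℕ)) * ε j := by
    funext j
    conv_rhs => rw [hεp j]
    rw [← mul_assoc, zpow_sub_one_mul_pow hl hlk, one_mul]
  have hfield : field (a' (h ε)) (h ε) (l * x) = l * field (a ε) ε x := by
    rw [← hap]
    conv_lhs => rw [hh]
    rw [field_scale, hlk, mul_one, pow_succ, hlk, one_mul]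
  rw [hfield, inv_mul_cancel_left₀ hl] at key
  rw [← key]
  field_simp

/-! ### Analytic dependence of the flow, by the implicit function theorem on a space of paths. -/

/-- The space of continuous complex paths parametrised by `[0, 1]`. -/
abbrev PathSpace : Type := C(Icc (0 : ℝ) 1, ℂ)

/-- Integration of a path from `0`. -/
noncomputable def pathIntegral : PathSpace →L[ℂ] PathSpace :=
  LinearMap.mkContinuous
    { toFun := fun γ =>
        ⟨fun s => ∫ u in (0 : ℝ)..s, IccExtend zero_le_one γ u, by
          have hc : Continuous (IccExtend (zero_le_one (α := ℝ)) γ) := γ.continuous.Icc_extend'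
          exact (intervalIntegral.continuous_primitive
            (fun a b => hc.intervalIntegrable a b) 0).comp continuous_subtype_val⟩
      map_add' := fun γ η => by
        ext s
        have h1 : Continuous (IccExtend (zero_le_one (α := ℝ)) γ) := γ.continuous.Icc_extend'
        have h2 : Continuous (IccExtend (zero_le_one (α := ℝ)) η) := η.continuous.Icc_extend'
        exact intervalIntegral.integral_add (h1.intervalIntegrable 0 s) (h2.intervalIntegrable 0 s)
      map_smul' := fun c γ => by
        ext s
        exact intervalIntegral.integral_const_mul c _ } 1 (fun γ => by
    rw [one_mul, ContinuousMap.norm_le _ (norm_nonneg _)]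
    intro s
    have h := intervalIntegral.norm_integral_le_of_norm_le_const (a := 0) (b := (s : ℝ))
      (f := IccExtend (zero_le_one (α := ℝ)) γ) (C := ‖γ‖) (fun u _ => γ.norm_coe_le_norm _)
    refine h.trans ?_
    rw [sub_zero, abs_of_nonneg s.2.1]
    exact mul_le_of_le_one_right (norm_nonneg _) s.2.2)

theorem hasDerivWithinAt_pathIntegral (γ : PathSpace) {s : ℝ} (hs : s ∈ Icc (0 : ℝ) 1) :
    HasDerivWithinAt (IccExtend (zero_le_one (α := ℝ)) (pathIntegral γ)) (γ ⟨s, hs⟩)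
      (Icc (0 : ℝ) 1) s := by
  have hc : Continuous (IccExtend (zero_le_one (α := ℝ)) γ) := γ.continuous.Icc_extend'
  have h := (hc.integral_hasStrictDerivAt 0 s).hasDerivAt.hasDerivWithinAt (s := Icc (0 : ℝ) 1)
  rw [IccExtend_of_mem _ _ hs] at h
  refine h.congr (fun u hu => ?_) ?_
  · rw [IccExtend_of_mem _ _ hu]; rfl
  · rw [IccExtend_of_mem _ _ hs]; rfl

theorem pathIntegral_zero (γ : PathSpace) : pathIntegral γ ⟨0, by simp⟩ = 0 :=
  intervalIntegral.integral_same

theorem zero_smul_path (γ : PathSpace) : (0 : ℂ) • γ = 0 := zero_smul ℂ γ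

/-- The vector field `P_ε(x) / (1 + c x^k) ∂_x` acting on paths. -/
noncomputable def pathField (γ : PathSpace) (ε : Fin k → ℂ) (c : ℂ) : PathSpace :=
  (γ ^ (k + 1) + ∑ j : Fin k, ε j • γ ^ (j : ℕ)) * Ring.inverse (1 + c • γ ^ k)

theorem pathField_apply {γ : PathSpace} {c : ℂ} (hu : IsUnit (1 + c • γ ^ k)) (ε : Fin k → ℂ)
    (s : Icc (0 : ℝ) 1) :
    γ s ∈ fieldDomain k c ∧ pathField γ ε c s = field c ε (γ s) := by
  have h1 : (1 + c * γ s ^ k) * (Ring.inverse (1 + c • γ ^ k)) s = 1 := by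
    have := congrArg (fun η : PathSpace => η s) (Ring.mul_inverse_cancel _ hu)
    simpa using this
  have h0 : 1 + c * γ s ^ k ≠ 0 := left_ne_zero_of_mul_eq_one h1
  refine ⟨h0, ?_⟩
  have h2 : (Ring.inverse (1 + c • γ ^ k)) s = (1 + c * γ s ^ k)⁻¹ :=
    eq_inv_of_mul_eq_one_right h1
  simp [pathField, field, P, h2, div_eq_mul_inv, ContinuousMap.sum_apply]

/-- The defect of a path in the integral equation of the flow; the parameters are the time, the
coefficients of the vector field and the initial point. -/
noncomputable def flowEquation (p : (ℂ × (Fin k → ℂ) × ℂ × ℂ) × PathSpace) : PathSpace :=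
  p.2 - ContinuousMap.const _ p.1.2.2.2 - p.1.1 • pathIntegral (pathField p.2 p.1.2.1 p.1.2.2.1)

theorem flowsTo_of_flowEquation_eq_zero {t c x : ℂ} {ε : Fin k → ℂ} {γ : PathSpace}
    (h : flowEquation ((t, ε, c, x), γ) = 0) (hu : IsUnit (1 + c • γ ^ k)) :
    FlowsTo (fieldDomain k c) (field c ε) t x (γ ⟨1, by simp⟩) := by
  have hγ : γ = ContinuousMap.const _ x + t • pathIntegral (pathField γ ε c) := by
    rw [flowEquation, sub_sub, sub_eq_zero] at h
    exact h
  refine ⟨IccExtend (zero_le_one (α := ℝ)) γ, ?_, ?_, fun s hs => ?_⟩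
  · rw [IccExtend_of_mem _ _ (by simp : (0 : ℝ) ∈ Icc (0 : ℝ) 1), hγ]
    rw [ContinuousMap.add_apply, ContinuousMap.smul_apply, pathIntegral_zero]
    simp
  · rw [IccExtend_of_mem _ _ (by simp : (1 : ℝ) ∈ Icc (0 : ℝ) 1)]
  · obtain ⟨h1, h2⟩ := pathField_apply hu ε ⟨s, hs⟩
    rw [IccExtend_of_mem _ _ hs]
    refine ⟨h1, ?_⟩
    rw [← h2]
    have hd := ((hasDerivWithinAt_pathIntegral (pathField γ ε c) hs).const_mul t).const_add x
    refine hd.congr (fun u hu => ?_) ?_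
    · rw [IccExtend_of_mem _ _ hu, IccExtend_of_mem _ _ hu]
      exact congrArg (fun η : PathSpace => η ⟨u, hu⟩) hγ
    · rw [IccExtend_of_mem _ _ hs, IccExtend_of_mem _ _ hs]
      exact congrArg (fun η : PathSpace => η ⟨s, hs⟩) hγ

/-- At `c = 0` the denominator is the unit `1` of the Banach algebra of paths, and inversion is
analytic near a unit. -/
theorem contDiffAt_pathField (x : ℂ) :
    ContDiffAt ℂ ω (fun p : (ℂ × (Fin k → ℂ) × ℂ × ℂ) × PathSpace =>
      pathField p.2 p.1.2.1 p.1.2.2.1) ((0, 0, 0, x), ContinuousMap.const _ x) := by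
  unfold pathField
  refine ContDiffAt.mul ?_ ?_
  · fun_prop
  · have h1 : ContDiffAt ℂ ω (fun p : (ℂ × (Fin k → ℂ) × ℂ × ℂ) × PathSpace =>
      (1 + p.1.2.2.1 • p.2 ^ k : PathSpace)) ((0, 0, 0, x), ContinuousMap.const _ x) := by
      fun_prop
    refine ContDiffAt.comp (g := Ring.inverse) _ ?_ h1
    have : (1 : PathSpace) + (0 : ℂ) • (ContinuousMap.const _ x : PathSpace) ^ k
        = ((1 : PathSpaceˣ) : PathSpace) := by simp [zero_smul_path]
    simp only [this]
    exact contDiffAt_ringInverse ℂ 1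

theorem contDiffAt_flowEquation (x : ℂ) :
    ContDiffAt ℂ ω (flowEquation (k := k)) ((0, 0, 0, x), ContinuousMap.const _ x) := by
  unfold flowEquation
  have h1 : ContDiff ℂ ω (fun p : (ℂ × (Fin k → ℂ) × ℂ × ℂ) × PathSpace =>
      (ContinuousMap.const (Icc (0 : ℝ) 1) p.1.2.2.2 : PathSpace)) := by
    have h0 : (fun p : (ℂ × (Fin k → ℂ) × ℂ × ℂ) × PathSpace =>
        (ContinuousMap.const (Icc (0 : ℝ) 1) p.1.2.2.2 : PathSpace))
        = fun p => p.1.2.2.2 • (1 : PathSpace) := by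
      funext p; ext s; simp
    rw [h0]
    fun_prop
  have h2 := contDiffAt_pathField (k := k) x
  have h3 := pathIntegral.contDiff (n := ω).contDiffAt.comp _ h2
  refine (contDiffAt_snd.sub h1.contDiffAt).sub ?_
  exact (by fun_prop : ContDiffAt ℂ ω (fun p : (ℂ × (Fin k → ℂ) × ℂ × ℂ) × PathSpace =>
    p.1.1) _).smul h3

/-- At time `0` the integral term drops out and the equation in the path is a translation; this is
the invertibility needed to solve for the path. -/
theorem fderiv_flowEquation_inr (x : ℂ) :
    fderiv ℂ (flowEquation (k := k)) ((0, 0, 0, x), ContinuousMap.const _ x) ∘L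
      .inr ℂ (ℂ × (Fin k → ℂ) × ℂ × ℂ) PathSpace = .id ℂ PathSpace := by
  have hd := (contDiffAt_flowEquation (k := k) x).differentiableAt (by simp)
  have h1 : HasFDerivAt (fun γ : PathSpace => (((0, 0, 0, x), γ) :
      (ℂ × (Fin k → ℂ) × ℂ × ℂ) × PathSpace)) (.inr ℂ (ℂ × (Fin k → ℂ) × ℂ × ℂ) PathSpace)
      (ContinuousMap.const _ x) := hasFDerivAt_prodMk_right _ _
  have h2 := hd.hasFDerivAt.comp (ContinuousMap.const _ x : PathSpace) h1
  have h3 : HasFDerivAt (flowEquation (k := k) ∘ fun γ : PathSpace => (((0, 0, 0, x), γ) :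
      (ℂ × (Fin k → ℂ) × ℂ × ℂ) × PathSpace)) (.id ℂ PathSpace)
      (ContinuousMap.const _ x : PathSpace) := by
    have : (flowEquation (k := k) ∘ fun γ : PathSpace => (((0, 0, 0, x), γ) :
        (ℂ × (Fin k → ℂ) × ℂ × ℂ) × PathSpace)) = fun γ => γ - ContinuousMap.const _ x := by
      funext γ; simp [flowEquation, zero_smul_path]
    rw [this]
    exact (hasFDerivAt_id _).sub_const _
  exact h2.unique h3

/-- Near the zero time and the zero parameters, the flow exists and depends analytically on the
time, the parameters and the initial point. -/
theorem exists_local_flow (x : ℂ) :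
    ∃ g : ℂ × (Fin k → ℂ) × ℂ × ℂ → ℂ, AnalyticAt ℂ g (0, 0, 0, x) ∧
      ∀ᶠ p in 𝓝 ((0, 0, 0, x) : ℂ × (Fin k → ℂ) × ℂ × ℂ),
        FlowsTo (fieldDomain k p.2.2.1) (field p.2.2.1 p.2.1) p.1 p.2.2.2 (g p) := by
  have hcd := contDiffAt_flowEquation (k := k) x
  have hinv : (fderiv ℂ (flowEquation (k := k)) ((0, 0, 0, x), ContinuousMap.const _ x) ∘L
      .inr ℂ (ℂ × (Fin k → ℂ) × ℂ × ℂ) PathSpace).IsInvertible := by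
    rw [fderiv_flowEquation_inr]
    exact ⟨ContinuousLinearEquiv.refl ℂ PathSpace, rfl⟩
  have hG := hcd.contDiffAt_implicitFunction (by simp) hinv
  set G := hcd.implicitFunction (by simp) hinv with hGdef
  have hG0 : G (0, 0, 0, x) = ContinuousMap.const _ x :=
    hcd.implicitFunction_apply_self (by simp) hinv
  refine ⟨fun p => ContinuousMap.evalCLM ℂ (⟨1, by simp⟩ : Icc (0 : ℝ) 1) (G p), ?_, ?_⟩
  · exact ((ContinuousMap.evalCLM ℂ (⟨1, by simp⟩ : Icc (0 : ℝ) 1)).contDiff.contDiffAt.comp _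
      hG).analyticAt
  · have h1 := hcd.eventually_apply_implicitFunction (by simp) hinv
    have hcont : ContinuousAt (fun p : ℂ × (Fin k → ℂ) × ℂ × ℂ => (1 + p.2.2.1 • G p ^ k : PathSpace))
        (0, 0, 0, x) := by
      have := hG.continuousAt
      fun_prop
    have h2 : ∀ᶠ p in 𝓝 ((0, 0, 0, x) : ℂ × (Fin k → ℂ) × ℂ × ℂ),
        IsUnit (1 + p.2.2.1 • G p ^ k : PathSpace) := by
      refine hcont.eventually (Units.isOpen.mem_nhds ?_)
      simp [zero_smul_path]
    filter_upwards [h1, h2] with p hp1 hp2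
    refine flowsTo_of_flowEquation_eq_zero (γ := G p) ?_ hp2
    refine Eq.trans hp1 ?_
    simp [flowEquation, zero_smul_path]

/-- The flow at the time `p.1` of the vector field with the parameters `p.2.1`, `p.2.2.1`, from
the point `p.2.2.2` (where it is defined). -/
noncomputable def flowMap (p : ℂ × (Fin k → ℂ) × ℂ × ℂ) : ℂ :=
  Classical.epsilon fun y =>
    FlowsTo (fieldDomain k p.2.2.1) (field p.2.2.1 p.2.1) p.1 p.2.2.2 y

theorem flowMap_eq {p : ℂ × (Fin k → ℂ) × ℂ × ℂ} {y : ℂ}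
    (h : FlowsTo (fieldDomain k p.2.2.1) (field p.2.2.1 p.2.1) p.1 p.2.2.2 y) :
    flowMap p = y :=
  (Classical.epsilon_spec ⟨y, h⟩ : FlowsTo _ _ _ _ (flowMap p)).unique (isOpen_fieldDomain _ _)
    (differentiableOn_field _ _) h

/-- Uniqueness of trajectories glues the local flows built around the various `x` into one function.
-/
theorem flowMap_spec (x : ℂ) : AnalyticAt ℂ (flowMap (k := k)) (0, 0, 0, x) ∧
    ∀ᶠ p in 𝓝 ((0, 0, 0, x) : ℂ × (Fin k → ℂ) × ℂ × ℂ),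
      FlowsTo (fieldDomain k p.2.2.1) (field p.2.2.1 p.2.1) p.1 p.2.2.2 (flowMap p) := by
  obtain ⟨g, hg, h⟩ := exists_local_flow (k := k) x
  have heq : g =ᶠ[𝓝 (0, 0, 0, x)] flowMap := by
    filter_upwards [h] with p hp using (flowMap_eq hp).symm
  refine ⟨hg.congr heq, ?_⟩
  filter_upwards [h] with p hp
  rwa [flowMap_eq hp]

theorem flowsTo_zero_time {U : Set ℂ} {f : ℂ → ℂ} {x : ℂ} (hx : x ∈ U) : FlowsTo U f 0 x x :=
  ⟨fun _ => x, rfl, rfl, fun s _ => ⟨hx, by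
    rw [zero_mul]; exact hasDerivWithinAt_const _ _ _⟩⟩

theorem flowMap_zero (x : ℂ) : flowMap ((0, 0, 0, x) : ℂ × (Fin k → ℂ) × ℂ × ℂ) = x :=
  flowMap_eq (flowsTo_zero_time (by simp [fieldDomain]))

theorem flowsTo_partial_time {U : Set ℂ} {f : ℂ → ℂ} {t : ℂ} {γ : ℝ → ℂ}
    (hγ : ∀ s ∈ Icc (0 : ℝ) 1,
      γ s ∈ U ∧ HasDerivWithinAt γ (t * f (γ s)) (Icc (0 : ℝ) 1) s) {s : ℝ}
    (hs : s ∈ Icc (0 : ℝ) 1) : FlowsTo U f (s * t) (γ 0) (γ s) := by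
  have hmaps : MapsTo (fun u : ℝ => s * u) (Icc (0 : ℝ) 1) (Icc (0 : ℝ) 1) := fun u hu =>
    ⟨mul_nonneg hs.1 hu.1, mul_le_one₀ hs.2 hu.1 hu.2⟩
  refine ⟨fun u => γ (s * u), by simp, by simp, fun u hu => ⟨(hγ _ (hmaps hu)).1, ?_⟩⟩
  have h1 : HasDerivWithinAt (fun u : ℝ => s * u) s (Icc (0 : ℝ) 1) u := by
    simpa using ((hasDerivAt_id u).const_mul s).hasDerivWithinAt
  have h2 := (hγ _ (hmaps hu)).2.scomp u h1 hmaps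
  rw [Complex.real_smul, ← mul_assoc] at h2
  exact h2

theorem hasDerivAt_flowMap_time (x : ℂ) :
    HasDerivAt (fun t => flowMap ((t, 0, 0, x) : ℂ × (Fin k → ℂ) × ℂ × ℂ)) (x ^ (k + 1)) 0 := by
  obtain ⟨ha, hf⟩ := flowMap_spec (k := k) x
  set F : ℂ → ℂ := fun t => flowMap ((t, 0, 0, x) : ℂ × (Fin k → ℂ) × ℂ × ℂ) with hF
  have hline : DifferentiableAt ℂ (fun t : ℂ => ((t, 0, 0, x) : ℂ × (Fin k → ℂ) × ℂ × ℂ)) 0 := by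
    fun_prop
  have hd : DifferentiableAt ℂ F 0 :=
    DifferentiableAt.comp (f := fun t : ℂ => ((t, 0, 0, x) : ℂ × (Fin k → ℂ) × ℂ × ℂ)) 0
      ha.differentiableAt hline
  have hev : ∀ᶠ t : ℂ in 𝓝[≠] 0, FlowsTo (fieldDomain k 0) (field 0 (0 : Fin k → ℂ)) t x (F t) :=
    nhdsWithin_le_nhds (hline.continuousAt.eventually hf)
  -- Complex differentiability being known, the derivative can be read off along the single real ray
  -- `s * t`, on which `F` is the trajectory `γ`.
  obtain ⟨t, ⟨γ, h0, h1, hγ⟩, ht⟩ := (hev.and self_mem_nhdsWithin).exists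
  have hFγ : ∀ s ∈ Icc (0 : ℝ) 1, F (s * t) = γ s := fun s hs =>
    flowMap_eq (p := (s * t, 0, 0, x)) (h0 ▸ flowsTo_partial_time hγ hs)
  have e1 : HasDerivWithinAt γ (t * deriv F 0) (Icc (0 : ℝ) 1) 0 := by
    have hl : HasDerivAt (fun s : ℝ => (s : ℂ) * t) t 0 := by
      simpa using (Complex.ofRealCLM.hasDerivAt (x := 0)).mul_const t
    have hF0 : HasDerivAt F (deriv F 0) ((fun s : ℝ => (s : ℂ) * t) 0) := by
      simpa using hd.hasDerivAt
    have := (hF0.scomp (0 : ℝ) hl).hasDerivWithinAt (s := Icc (0 : ℝ) 1)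
    exact this.congr (fun s hs => (hFγ s hs).symm) (hFγ 0 (by simp)).symm
  have e2 := (hγ 0 (by simp)).2
  have e3 := (uniqueDiffOn_Icc zero_lt_one 0 (by simp)).eq_deriv _ e1 e2
  have e4 : deriv F 0 = x ^ (k + 1) := by
    have := mul_left_cancel₀ ht e3
    rw [this, h0]
    simp [field, P_zero]
  exact e4 ▸ hd.hasDerivAt

/-- The time needed to flow from `1` to a nearby point `y` depends analytically on `y` and on the
parameters. -/
theorem exists_transit_time (k : ℕ) : ∃ τ : ℂ × (Fin k → ℂ) × ℂ → ℂ, AnalyticAt ℂ τ (1, 0, 0) ∧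
    τ (1, 0, 0) = 0 ∧ ∀ᶠ q in 𝓝 ((1, 0, 0) : ℂ × (Fin k → ℂ) × ℂ),
      flowMap (τ q, q.2.1, q.2.2, 1) = q.1 := by
  set F : (ℂ × (Fin k → ℂ) × ℂ) × ℂ → ℂ := fun p => flowMap (p.2, p.1.2.1, p.1.2.2, 1) - p.1.1
    with hF
  have hcd : ContDiffAt ℂ ω F ((1, 0, 0), 0) := by
    have h1 : ContDiffAt ℂ ω (flowMap (k := k)) (0, 0, 0, 1) := (flowMap_spec 1).1.contDiffAt
    have h2 : ContDiffAt ℂ ω (fun p : (ℂ × (Fin k → ℂ) × ℂ) × ℂ =>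
      ((p.2, p.1.2.1, p.1.2.2, 1) : ℂ × (Fin k → ℂ) × ℂ × ℂ)) ((1, 0, 0), 0) := by fun_prop
    have h3 : ContDiffAt ℂ ω (fun p : (ℂ × (Fin k → ℂ) × ℂ) × ℂ => p.1.1) ((1, 0, 0), 0) := by
      fun_prop
    exact (h1.comp ((1, 0, 0), 0) h2).sub h3
  have hinr : fderiv ℂ F ((1, 0, 0), 0) ∘L .inr ℂ (ℂ × (Fin k → ℂ) × ℂ) ℂ = .id ℂ ℂ := by
    have hd := (hcd.differentiableAt (by simp)).hasFDerivAt
    have h1 : HasFDerivAt (fun t : ℂ => (((1, 0, 0), t) : (ℂ × (Fin k → ℂ) × ℂ) × ℂ))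
      (.inr ℂ (ℂ × (Fin k → ℂ) × ℂ) ℂ) 0 := hasFDerivAt_prodMk_right _ _
    have h2 := hd.comp (0 : ℂ) h1
    -- From the point `1` the time derivative is `1 ^ (k + 1) = 1`, so the equation can be solved
    -- for the time.
    have h3 := (hasDerivAt_flowMap_time (k := k) 1).sub_const 1
    ext
    simpa using h2.hasDerivAt.unique h3
  have hinv : (fderiv ℂ F ((1, 0, 0), 0) ∘L .inr ℂ (ℂ × (Fin k → ℂ) × ℂ) ℂ).IsInvertible := by
    rw [hinr]
    exact ⟨ContinuousLinearEquiv.refl ℂ ℂ, rfl⟩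
  refine ⟨hcd.implicitFunction (by simp) hinv,
    (hcd.contDiffAt_implicitFunction (by simp) hinv).analyticAt,
    hcd.implicitFunction_apply_self (by simp) hinv, ?_⟩
  filter_upwards [hcd.eventually_apply_implicitFunction (by simp) hinv] with q hq
  simpa [hF, flowMap_zero, sub_eq_zero] using hq

/-- Near the trivial time and parameters, the flow is close to the identity on the closed unit
disc, together with its derivative. -/
theorem eventually_flowMap_close {δ : ℝ} (hδ : 0 < δ) :
    ∀ᶠ p in 𝓝 ((0, 0, 0) : ℂ × (Fin k → ℂ) × ℂ), ∀ x ∈ Metric.closedBall (0 : ℂ) 1,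
      AnalyticAt ℂ (fun z => flowMap (p.1, p.2.1, p.2.2, z)) x ∧
      (∀ᶠ z in 𝓝 x, FlowsTo (fieldDomain k p.2.2) (field p.2.2 p.2.1) p.1 z
        (flowMap (p.1, p.2.1, p.2.2, z))) ∧
      ‖flowMap (p.1, p.2.1, p.2.2, x) - x‖ < δ ∧
      ‖deriv (fun z => flowMap (p.1, p.2.1, p.2.2, z)) x - 1‖ < δ := by
  refine (isCompact_closedBall (0 : ℂ) 1).eventually_forall_of_forall_eventually fun x _ => ?_
  obtain ⟨ha, hf⟩ := flowMap_spec (k := k) x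
  set v : ℂ × (Fin k → ℂ) × ℂ × ℂ := (0, 0, 0, 1) with hv
  have hderiv : ∀ p : ℂ × (Fin k → ℂ) × ℂ × ℂ, AnalyticAt ℂ (flowMap (k := k)) p →
      HasDerivAt (fun z => flowMap (p.1, p.2.1, p.2.2.1, z)) (fderiv ℂ flowMap p v) p.2.2.2 := by
    intro p hp
    have h1 : HasDerivAt (fun z : ℂ => ((p.1, p.2.1, p.2.2.1, z) : ℂ × (Fin k → ℂ) × ℂ × ℂ)) v
        p.2.2.2 :=
      (hasDerivAt_const _ _).prodMk ((hasDerivAt_const _ _).prodMk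
        ((hasDerivAt_const _ _).prodMk (hasDerivAt_id _)))
    exact hp.differentiableAt.hasFDerivAt.comp_hasDerivAt (p.2.2.2) h1
  have hbase : fderiv ℂ flowMap ((0, 0, 0, x) : ℂ × (Fin k → ℂ) × ℂ × ℂ) v = 1 := by
    have h1 := hderiv _ ha
    simp only [flowMap_zero] at h1
    exact h1.unique (hasDerivAt_id x)
  have hmap : Tendsto (fun q : (ℂ × (Fin k → ℂ) × ℂ) × ℂ =>
      ((q.1.1, q.1.2.1, q.1.2.2, q.2) : ℂ × (Fin k → ℂ) × ℂ × ℂ)) (𝓝 ((0, 0, 0), x))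
      (𝓝 (0, 0, 0, x)) :=
    Continuous.tendsto' (by fun_prop) _ _ rfl
  have hc1 : ∀ᶠ p : ℂ × (Fin k → ℂ) × ℂ × ℂ in 𝓝 (0, 0, 0, x), ‖flowMap p - p.2.2.2‖ < δ := by
    have : ContinuousAt (fun p : ℂ × (Fin k → ℂ) × ℂ × ℂ => ‖flowMap p - p.2.2.2‖)
        (0, 0, 0, x) := by
      have := ha.continuousAt
      fun_prop
    exact this.eventually_lt continuousAt_const (by simpa [flowMap_zero] using hδ)
  have hc2 : ∀ᶠ p : ℂ × (Fin k → ℂ) × ℂ × ℂ in 𝓝 (0, 0, 0, x),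
      ‖fderiv ℂ flowMap p v - 1‖ < δ := by
    have : ContinuousAt (fun p : ℂ × (Fin k → ℂ) × ℂ × ℂ => ‖fderiv ℂ flowMap p v - 1‖)
        (0, 0, 0, x) := by
      have := ha.fderiv.continuousAt
      fun_prop
    exact this.eventually_lt continuousAt_const (by simpa [hbase] using hδ)
  filter_upwards [hmap.eventually ha.eventually_analyticAt, hmap.eventually hf.eventually_nhds,
    hmap.eventually hc1, hmap.eventually hc2] with q h1 h2 h3 h4
  refine ⟨?_, ?_, h3, ?_⟩
  · have : AnalyticAt ℂ (fun z : ℂ =>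
      ((q.1.1, q.1.2.1, q.1.2.2, z) : ℂ × (Fin k → ℂ) × ℂ × ℂ)) q.2 := by fun_prop
    exact AnalyticAt.comp (f := fun z : ℂ =>
      ((q.1.1, q.1.2.1, q.1.2.2, z) : ℂ × (Fin k → ℂ) × ℂ × ℂ)) h1 this
  · have hz : Tendsto (fun z : ℂ => ((q.1.1, q.1.2.1, q.1.2.2, z) : ℂ × (Fin k → ℂ) × ℂ × ℂ))
        (𝓝 q.2) (𝓝 (q.1.1, q.1.2.1, q.1.2.2, q.2)) :=
      Continuous.tendsto' (by fun_prop) _ _ rfl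
    exact hz.eventually h2
  · rw [(hderiv _ h1).deriv]
    exact h4

/-! ### Residue estimates for the linearised conjugacy equation. -/

/-- A bound for the residue term of a function on the unit circle. -/
theorem norm_residue_le {R G : ℂ → ℂ} {b : ℂ} {m : ℝ} {n : ℕ}
    (hG : ContinuousOn G (sphere 0 1)) (hI : (∮ z in C(0, 1), G z) = 0)
    (hR : ∀ z ∈ sphere (0 : ℂ) 1, R z * (z ^ n)⁻¹ = G z + b * z⁻¹)
    (hm : ∀ z ∈ sphere (0 : ℂ) 1, ‖R z‖ ≤ m) : ‖b‖ ≤ m := by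
  have h0 : ∀ z ∈ sphere (0 : ℂ) 1, z ≠ 0 := fun z hz => ne_of_mem_sphere hz one_ne_zero
  have hint : (∮ z in C(0, 1), (G z + b * z⁻¹)) = b * (2 * Real.pi * Complex.I) := by
    have hc : ContinuousOn (fun z : ℂ => b * z⁻¹) (sphere 0 1) :=
      continuousOn_const.mul (continuousOn_inv₀.mono fun z hz => h0 z hz)
    rw [circleIntegral.integral_add (hG.circleIntegrable zero_le_one)
      (hc.circleIntegrable zero_le_one), hI, zero_add, circleIntegral.integral_const_mul]
    have := circleIntegral.integral_sub_center_inv 0 (one_ne_zero (α := ℝ))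
    simp only [sub_zero] at this
    rw [this]
  have hle := circleIntegral.norm_integral_le_of_norm_le_const (f := fun z => G z + b * z⁻¹)
    (c := 0) (R := 1) (C := m) zero_le_one (fun z hz => by
      have hz1 : ‖z‖ = 1 := by simpa using hz
      rw [← hR z hz, norm_mul, norm_inv, norm_pow, hz1]
      simpa using hm z hz)
  rw [hint] at hle
  have hpi := Real.pi_pos
  have e : ‖b * (2 * Real.pi * Complex.I)‖ = 2 * Real.pi * 1 * ‖b‖ := by
    simp [abs_of_pos hpi, mul_comm]
  rw [e] at hle
  exact le_of_mul_le_mul_left hle (by positivity)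

/-- The linearisation, at the identity and at `P_0`, of the conjugacy equation. -/
noncomputable def linearization (u : ℂ → ℂ) (η : Fin k → ℂ) (β x : ℂ) : ℂ :=
  x ^ (k + 1) * deriv u x + β * x ^ (2 * k + 1) - (k + 1) * x ^ k * u x
    - ∑ j : Fin k, η j * x ^ (j : ℕ)

/-- Divide by `x ^ (j + 1)`: as `j < k`, the terms in `u` and `β` stay holomorphic, the other
monomials have no residue, and `-η j / x` remains. -/
theorem norm_coeff_le_of_linearization {u : ℂ → ℂ}
    (hu : ∀ x ∈ closedBall (0 : ℂ) 1, AnalyticAt ℂ u x) {η : Fin k → ℂ} {β : ℂ} {m : ℝ}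
    (hm : ∀ x ∈ sphere (0 : ℂ) 1, ‖linearization u η β x‖ ≤ m) (j : Fin k) : ‖η j‖ ≤ m := by
  have h0 : ∀ z ∈ sphere (0 : ℂ) 1, z ≠ 0 := fun z hz => ne_of_mem_sphere hz one_ne_zero
  set H : ℂ → ℂ := fun x => x ^ (k - 1 - (j : ℕ)) *
    (x * deriv u x + β * x ^ (k + 1) - (k + 1) * u x) with hH
  have hHd : ∀ x ∈ closedBall (0 : ℂ) 1, DifferentiableAt ℂ H x := by
    intro x hx
    have h1 := (hu x hx).differentiableAt
    have h2 := (hu x hx).deriv.differentiableAt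
    fun_prop
  have hHc : ContinuousOn H (closedBall 0 1) := fun x hx =>
    (hHd x hx).continuousAt.continuousWithinAt
  have hHI : (∮ z in C(0, 1), H z) = 0 :=
    Complex.circleIntegral_eq_zero_of_differentiable_on_off_countable zero_le_one countable_empty
      hHc fun z hz => hHd z (ball_subset_closedBall hz.1)
  set S : Fin k → ℂ → ℂ := fun i x => if i = j then 0 else η i * (x - 0) ^ (((i : ℕ) : ℤ) - j - 1)
    with hS
  have hSc : ∀ i, ContinuousOn (S i) (sphere 0 1) := by
    intro i
    by_cases hij : i = j
    · simp only [hS, hij, if_true]; exact continuousOn_const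
    · simp only [hS, hij, if_false, sub_zero]
      exact continuousOn_const.mul (continuousOn_id.zpow₀ _ fun z hz => Or.inl (h0 z hz))
  have hSI : ∀ i, (∮ z in C(0, 1), S i z) = 0 := by
    intro i
    by_cases hij : i = j
    · simp [hS, hij, circleIntegral]
    · simp only [hS, hij, if_false]
      rw [circleIntegral.integral_const_mul, circleIntegral.integral_sub_zpow_of_ne, mul_zero]
      intro h
      apply hij
      ext
      omega
  have key := norm_residue_le (R := linearization u η β) (G := fun x => H x - ∑ i, S i x)
    (b := -η j) (m := m) (n := (j : ℕ) + 1)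
    ((hHc.mono sphere_subset_closedBall).sub (continuousOn_finsetSum _ fun i _ => hSc i)) ?_ ?_ hm
  · simpa using key
  · have hsum : ContinuousOn (fun x => ∑ i, S i x) (sphere (0 : ℂ) 1) :=
      continuousOn_finsetSum _ fun i _ => hSc i
    rw [circleIntegral.integral_sub
      ((hHc.mono sphere_subset_closedBall).circleIntegrable zero_le_one)
      (hsum.circleIntegrable zero_le_one), hHI,
      circleIntegral.integral_fun_sum fun i _ => (hSc i).circleIntegrable zero_le_one]
    simp [hSI]
  · intro x hx
    have hx0 := h0 x hx
    have e1 : ∑ i, S i x = (∑ i : Fin k, η i * x ^ (i : ℕ)) * (x ^ ((j : ℕ) + 1))⁻¹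
        - η j * x⁻¹ := by
      rw [← Finset.add_sum_erase _ _ (Finset.mem_univ j),
        ← Finset.add_sum_erase _ (fun i : Fin k => η i * x ^ (i : ℕ)) (Finset.mem_univ j), add_mul]
      have e2 : η j * x ^ (j : ℕ) * (x ^ ((j : ℕ) + 1))⁻¹ = η j * x⁻¹ := by
        rw [pow_succ]; field_simp
      have e3 : S j x = 0 := by simp [hS]
      rw [e2, e3, zero_add, add_sub_cancel_left, Finset.sum_mul]
      refine Finset.sum_congr rfl fun i hi => ?_
      simp only [hS, Finset.ne_of_mem_erase hi, if_false, sub_zero]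
      rw [mul_assoc, sub_sub, zpow_sub₀ hx0, zpow_natCast, div_eq_mul_inv]
      norm_cast
    have e4 : x ^ k = x ^ (k - 1 - (j : ℕ)) * x ^ ((j : ℕ) + 1) := by
      rw [← pow_add]; congr 1; have := j.2; omega
    have e5 : linearization u η β x = H x * x ^ ((j : ℕ) + 1)
        - ∑ i : Fin k, η i * x ^ (i : ℕ) := by
      have e6 : x ^ (k + 1) = x ^ k * x := pow_succ x k
      have e7 : x ^ (2 * k + 1) = x ^ k * x ^ (k + 1) := by rw [← pow_add]; congr 1; omega
      simp only [linearization, hH]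
      rw [e7, e6, e4]
      ring
    simp only [e1, e5]
    field_simp
    ring

/-- Divide by `x ^ (2 * k + 2)`: the terms in `u` form the derivative of `u x * x ^ (-(k + 1))`, the
terms in `η` have exponents below `-1`, and `β / x` remains. -/
theorem norm_top_coeff_le_of_linearization {u : ℂ → ℂ}
    (hu : ∀ x ∈ closedBall (0 : ℂ) 1, AnalyticAt ℂ u x) {η : Fin k → ℂ} {β : ℂ} {m : ℝ}
    (hm : ∀ x ∈ sphere (0 : ℂ) 1, ‖linearization u η β x‖ ≤ m) : ‖β‖ ≤ m := by
  have h0 : ∀ z ∈ sphere (0 : ℂ) 1, z ≠ 0 := fun z hz => ne_of_mem_sphere hz one_ne_zero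
  set H : ℂ → ℂ := fun x => deriv u x * (x - 0) ^ (-((k : ℤ) + 1))
    + u x * ((-((k : ℤ) + 1) : ℤ) * (x - 0) ^ (-((k : ℤ) + 1) - 1)) with hH
  have hcz : ∀ n : ℤ, ContinuousOn (fun x : ℂ => (x - 0) ^ n) (sphere 0 1) := fun n => by
    simp only [sub_zero]
    exact continuousOn_id.zpow₀ _ fun z hz => Or.inl (h0 z hz)
  have hHc : ContinuousOn H (sphere 0 1) := by
    have h1 : ContinuousOn u (sphere 0 1) := fun x hx =>
      (hu x (sphere_subset_closedBall hx)).continuousAt.continuousWithinAt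
    have h2 : ContinuousOn (deriv u) (sphere 0 1) := fun x hx =>
      (hu x (sphere_subset_closedBall hx)).deriv.continuousAt.continuousWithinAt
    exact (h2.mul (hcz _)).add (h1.mul (continuousOn_const.mul (hcz _)))
  have hHI : (∮ z in C(0, 1), H z) = 0 := by
    refine circleIntegral.integral_eq_zero_of_hasDerivWithinAt zero_le_one
      (f := fun x => u x * x ^ (-((k : ℤ) + 1))) fun x hx => ?_
    have h1 := (hu x (sphere_subset_closedBall hx)).differentiableAt.hasDerivAt
    have h2 := hasDerivAt_zpow (-((k : ℤ) + 1)) x (Or.inl (h0 x hx))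
    simp only [hH, sub_zero]
    exact (h1.mul h2).hasDerivWithinAt
  set S : Fin k → ℂ → ℂ := fun i x => η i * (x - 0) ^ (((i : ℕ) : ℤ) - (2 * k + 2)) with hS
  have hSc : ∀ i, ContinuousOn (S i) (sphere 0 1) := fun i => continuousOn_const.mul (hcz _)
  have hSI : ∀ i, (∮ z in C(0, 1), S i z) = 0 := by
    intro i
    simp only [hS]
    rw [circleIntegral.integral_const_mul, circleIntegral.integral_sub_zpow_of_ne, mul_zero]
    have := i.2
    omega
  have hsum : ContinuousOn (fun x => ∑ i, S i x) (sphere (0 : ℂ) 1) :=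
    continuousOn_finsetSum _ fun i _ => hSc i
  refine norm_residue_le (R := linearization u η β) (G := fun x => H x - ∑ i, S i x)
    (b := β) (m := m) (n := 2 * k + 2) (hHc.sub hsum) ?_ ?_ hm
  · rw [circleIntegral.integral_sub (hHc.circleIntegrable zero_le_one)
      (hsum.circleIntegrable zero_le_one), hHI,
      circleIntegral.integral_fun_sum fun i _ => (hSc i).circleIntegrable zero_le_one]
    simp [hSI]
  · intro x hx
    have hx0 := h0 x hx
    have e1 : ∑ i, S i x = (∑ i : Fin k, η i * x ^ (i : ℕ)) * (x ^ (2 * k + 2))⁻¹ := by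
      rw [Finset.sum_mul]
      refine Finset.sum_congr rfl fun i hi => ?_
      simp only [hS, sub_zero]
      rw [mul_assoc, zpow_sub₀ hx0, zpow_natCast, div_eq_mul_inv]
      norm_cast
    have e2 : x ^ (-((k : ℤ) + 1)) = (x ^ (k + 1))⁻¹ := by
      rw [zpow_neg]; norm_cast
    have e3 : x ^ (-((k : ℤ) + 1) - 1) = (x ^ (k + 2))⁻¹ := by
      rw [show -((k : ℤ) + 1) - 1 = -((k + 2 : ℕ) : ℤ) by push_cast; ring, zpow_neg, zpow_natCast]
    simp only [e1, hH, linearization, sub_zero, e2, e3]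
    rw [show x ^ (2 * k + 2) = x ^ k * x ^ k * x * x by ring,
      show x ^ (2 * k + 1) = x ^ k * x ^ k * x by ring, show x ^ (k + 2) = x ^ k * x * x by ring,
      show x ^ (k + 1) = x ^ k * x by ring]
    push_cast
    field_simp
    ring

/-- The linearised conjugacy equation controls its unknowns on the unit circle, once the
ambiguity coming from the flow has been removed by prescribing the value at `1`. -/
theorem norm_le_of_linearization {u : ℂ → ℂ}
    (hu : ∀ x ∈ closedBall (0 : ℂ) 1, AnalyticAt ℂ u x) (hu1 : u 1 = 0) {η : Fin k → ℂ} {β : ℂ}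
    {m : ℝ} (hm : ∀ x ∈ sphere (0 : ℂ) 1, ‖linearization u η β x‖ ≤ m) {x : ℂ}
    (hx : x ∈ sphere (0 : ℂ) 1) :
    ‖u x‖ ≤ 7 * (k + 2) ^ 2 * m ∧ ‖deriv u x‖ ≤ 7 * (k + 2) ^ 2 * m := by
  have hm0 : 0 ≤ m := (norm_nonneg _).trans (hm 1 (by simp))
  have hη := norm_coeff_le_of_linearization hu hm
  have hβ := norm_top_coeff_le_of_linearization hu hm
  have hD : ∀ x ∈ sphere (0 : ℂ) 1, ‖x * deriv u x - (k + 1) * u x‖ ≤ (k + 2) * m := by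
    intro x hx
    have hx1 : ‖x‖ = 1 := by simpa using hx
    have e : x ^ k * (x * deriv u x - (k + 1) * u x) = linearization u η β x
        - β * x ^ (2 * k + 1) + ∑ j : Fin k, η j * x ^ (j : ℕ) := by
      simp only [linearization]; ring
    have h1 : ‖x ^ k * (x * deriv u x - (k + 1) * u x)‖ ≤ m + m + k * m := by
      rw [e]
      refine (norm_add_le _ _).trans (add_le_add ((norm_sub_le _ _).trans
        (add_le_add (hm x hx) ?_)) ?_)
      · simpa [hx1] using hβ
      · refine (norm_sum_le _ _).trans ?_
        refine (Finset.sum_le_card_nsmul _ _ m fun j _ => ?_).trans (by simp)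
        simpa [hx1] using hη j
    rw [norm_mul, norm_pow, hx1, one_pow, one_mul] at h1
    linarith
  have hux : ‖u x‖ ≤ 7 * ((k + 2) * m) := by
    obtain ⟨θ, hθ, rfl⟩ : ∃ θ ∈ Ioc (0 : ℝ) (2 * Real.pi), circleMap 0 1 θ = x := by
      have := image_circleMap_Ioc 0 1
      rw [abs_one] at this
      rw [← this] at hx
      exact hx
    -- The integrating factor of `x * u' - (k + 1) * u`. Integration starts at `1`, where `u`
    -- vanishes, and covers a length at most `2 * π < 7`.
    set w : ℝ → ℂ := fun θ => u (circleMap 0 1 θ) * (circleMap 0 1 θ) ^ (-((k : ℤ) + 1)) with hw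
    have hmem : ∀ θ, circleMap 0 1 θ ∈ sphere (0 : ℂ) 1 := fun θ =>
      circleMap_mem_sphere 0 zero_le_one θ
    have hnorm : ∀ θ, ‖circleMap 0 1 θ‖ = 1 := fun θ => by simp
    have hwd : ∀ θ, HasDerivAt w
        ((circleMap 0 1 θ * Complex.I) * ((circleMap 0 1 θ) ^ (-((k : ℤ) + 1) - 1) *
          (circleMap 0 1 θ * deriv u (circleMap 0 1 θ) - (k + 1) * u (circleMap 0 1 θ)))) θ := by
      intro θ
      have h1 := (hu _ (sphere_subset_closedBall (hmem θ))).differentiableAt.hasDerivAt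
      have hne : circleMap 0 1 θ ≠ 0 := ne_of_mem_sphere (hmem θ) one_ne_zero
      have h2 := hasDerivAt_zpow (-((k : ℤ) + 1)) (circleMap 0 1 θ) (Or.inl hne)
      have h3 := (h1.mul h2).scomp θ (hasDerivAt_circleMap 0 1 θ)
      refine h3.congr_deriv ?_
      rw [smul_eq_mul, zpow_sub_one₀ hne]
      push_cast
      field_simp
      ring
    have hb := norm_image_sub_le_of_norm_deriv_le_segment' (a := 0) (b := θ) (f := w)
      (C := (k + 2) * m) (fun t _ => (hwd t).hasDerivWithinAt) (fun t _ => by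
        simp only [norm_mul, norm_zpow, hnorm, Complex.norm_I, one_zpow, one_mul]
        exact hD _ (hmem t)) θ ⟨hθ.1.le, le_rfl⟩
    have hw0 : w 0 = 0 := by simp [hw, circleMap, hu1]
    have hwθ : ‖w θ‖ = ‖u (circleMap 0 1 θ)‖ := by
      simp only [hw, norm_mul, norm_zpow, hnorm, one_zpow, mul_one]
    rw [hw0, sub_zero, sub_zero, hwθ] at hb
    have hθ7 : θ ≤ 7 := by have := Real.pi_lt_d2; linarith [hθ.2]
    calc _ ≤ _ := hb
      _ ≤ (k + 2) * m * 7 := by gcongr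
      _ = _ := by ring
  have hx1 : ‖x‖ = 1 := by simpa using hx
  have hk0 : (0 : ℝ) ≤ k := Nat.cast_nonneg k
  constructor
  · refine hux.trans ?_
    nlinarith [mul_nonneg hk0 hm0, mul_nonneg (mul_nonneg hk0 hk0) hm0]
  · have h1 : ‖x * deriv u x‖ ≤ (k + 2) * m + (k + 1) * (7 * ((k + 2) * m)) := by
      have e : x * deriv u x = (x * deriv u x - (k + 1) * u x) + (k + 1) * u x := by ring
      rw [e]
      refine (norm_add_le _ _).trans (add_le_add (hD x hx) ?_)
      rw [norm_mul]
      have : ‖(k : ℂ) + 1‖ = k + 1 := by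
        have := Complex.norm_natCast (k + 1)
        push_cast at this
        exact this
      rw [this]
      gcongr
    rw [norm_mul, hx1, one_mul] at h1
    refine h1.trans ?_
    nlinarith [mul_nonneg hk0 hm0, mul_nonneg (mul_nonneg hk0 hk0) hm0]

/-! ### Rigidity of conjugacies close to the identity. -/

/-- The divided difference of the monomial of degree `n`. -/
noncomputable def dividedPow (n : ℕ) (y z : ℂ) : ℂ :=
  ∑ i ∈ Finset.range n, y ^ i * z ^ (n - 1 - i)

theorem sub_mul_dividedPow (n : ℕ) (y z : ℂ) : (y - z) * dividedPow n y z = y ^ n - z ^ n :=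
  (Commute.all y z).mul_geom_sum₂ n

/-- The values of a conjugacy and of its derivative, a point, and the parameters of two members
of the family. -/
abbrev Jet (k : ℕ) : Type := ℂ × ℂ × ℂ × (Fin k → ℂ) × (Fin k → ℂ) × ℂ × ℂ

/-- The coefficient of `φ' - ψ'` in the remainder of the difference of two conjugacy equations. -/
noncomputable def coeffDeriv (x : ℂ) : Jet k → ℂ := fun (y, _, _, ε, _, _, b) =>
  x ^ (k + 1) - P ε x * (1 + b * y ^ k)

/-- The coefficient of `φ - ψ` in the remainder of the difference of two conjugacy equations. -/
noncomputable def coeffValue (x : ℂ) : Jet k → ℂ := fun (y, z, z', ε, h, a, _) =>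
  -((k + 1) * x ^ k) - a * z' * P ε x * dividedPow k y z
    + (1 + a * x ^ k) * (dividedPow (k + 1) y z + ∑ j : Fin k, h j * dividedPow j y z)

/-- The coefficient of `b - a` in the remainder of the difference of two conjugacy equations. -/
noncomputable def coeffTop (x : ℂ) : Jet k → ℂ := fun (y, _, z', ε, _, _, _) =>
  x ^ (2 * k + 1) - z' * P ε x * y ^ k

/-- The coefficient of `h_j - ε_j` in the remainder of the difference of two conjugacy
equations. -/
noncomputable def coeffLow (j : Fin k) (x : ℂ) : Jet k → ℂ := fun (_, z, _, _, _, a, _) =>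
  -x ^ (j : ℕ) + (1 + a * x ^ k) * z ^ (j : ℕ)

/-- Divided differences make this an exact identity, linear in the differences, with coefficients
vanishing at the identity and zero parameters. They do not involve `y'`, so closeness of `deriv φ`
to `1` is never required. -/
theorem linearization_eq_remainder {x y z y' z' a b : ℂ} {ε h : Fin k → ℂ}
    (h1 : y' * P ε x * (1 + b * y ^ k) = P h y * (1 + a * x ^ k))
    (h2 : z' * P ε x * (1 + a * z ^ k) = P ε z * (1 + a * x ^ k)) :
    x ^ (k + 1) * (y' - z') + (b - a) * x ^ (2 * k + 1) - (k + 1) * x ^ k * (y - z)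
        - ∑ j : Fin k, (h j - ε j) * x ^ (j : ℕ)
      = coeffDeriv x (y, z, z', ε, h, a, b) * (y' - z')
        + coeffValue x (y, z, z', ε, h, a, b) * (y - z)
        + coeffTop x (y, z, z', ε, h, a, b) * (b - a)
        + ∑ j : Fin k, coeffLow j x (y, z, z', ε, h, a, b) * (h j - ε j) := by
  have hP : P h y - P ε z = (y - z) * (dividedPow (k + 1) y z
      + ∑ j : Fin k, h j * dividedPow j y z) + ∑ j : Fin k, (h j - ε j) * z ^ (j : ℕ) := by
    rw [mul_add, sub_mul_dividedPow, Finset.mul_sum, add_assoc, ← Finset.sum_add_distrib]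
    have : ∀ j : Fin k, (y - z) * (h j * dividedPow j y z) + (h j - ε j) * z ^ (j : ℕ)
        = h j * y ^ (j : ℕ) - ε j * z ^ (j : ℕ) := fun j => by
      linear_combination h j * sub_mul_dividedPow j y z
    simp only [this, Finset.sum_sub_distrib, P]
    ring
  have hlow : ∑ j : Fin k, coeffLow j x (y, z, z', ε, h, a, b) * (h j - ε j)
      = -(∑ j : Fin k, (h j - ε j) * x ^ (j : ℕ))
        + (1 + a * x ^ k) * ∑ j : Fin k, (h j - ε j) * z ^ (j : ℕ) := by
    rw [Finset.mul_sum, ← Finset.sum_neg_distrib, ← Finset.sum_add_distrib]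
    refine Finset.sum_congr rfl fun j _ => ?_
    simp only [coeffLow]
    ring
  rw [hlow]
  simp only [coeffDeriv, coeffValue, coeffTop]
  linear_combination h1 - h2 + (1 + a * x ^ k) * hP
    + a * z' * P ε x * sub_mul_dividedPow k y z

/-- The remainder coefficients are uniformly small close to the identity. -/
theorem exists_small_coeff (k : ℕ) {κ : ℝ} (hκ : 0 < κ) :
    ∃ δ > 0, ∀ x ∈ sphere (0 : ℂ) 1, ∀ q : Jet k, ‖q - (x, x, 1, 0, 0, 0, 0)‖ < δ →
      ‖coeffDeriv x q‖ < κ ∧ ‖coeffValue x q‖ < κ ∧ ‖coeffTop x q‖ < κ ∧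
      ∀ j, ‖coeffLow j x q‖ < κ := by
  have hP : Continuous fun r : Jet k × ℂ => P r.1.2.2.2.1 r.2 :=
    continuous_P.comp (by fun_prop : Continuous fun r : Jet k × ℂ => (r.1.2.2.2.1, r.2))
  have hS : ∀ n, Continuous fun r : Jet k × ℂ => dividedPow n r.1.1 r.1.2.1 := fun n => by
    unfold dividedPow; fun_prop
  have c1 : Continuous fun r : Jet k × ℂ => ‖coeffDeriv r.2 r.1‖ := by
    unfold coeffDeriv; fun_prop
  have c2 : Continuous fun r : Jet k × ℂ => ‖coeffValue r.2 r.1‖ := by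
    unfold coeffValue; fun_prop
  have c3 : Continuous fun r : Jet k × ℂ => ‖coeffTop r.2 r.1‖ := by
    unfold coeffTop; fun_prop
  have c4 : ∀ j, Continuous fun r : Jet k × ℂ => ‖coeffLow j r.2 r.1‖ := fun j => by
    unfold coeffLow; fun_prop
  have hev : ∀ᶠ d : Jet k in 𝓝 0, ∀ x ∈ sphere (0 : ℂ) 1,
      ‖coeffDeriv x (d + (x, x, 1, 0, 0, 0, 0))‖ < κ ∧
      ‖coeffValue x (d + (x, x, 1, 0, 0, 0, 0))‖ < κ ∧
      ‖coeffTop x (d + (x, x, 1, 0, 0, 0, 0))‖ < κ ∧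
      ∀ j, ‖coeffLow j x (d + (x, x, 1, 0, 0, 0, 0))‖ < κ := by
    refine (isCompact_sphere (0 : ℂ) 1).eventually_forall_of_forall_eventually fun x _ => ?_
    have hm : Tendsto (fun r : Jet k × ℂ => (r.1 + (r.2, r.2, 1, 0, 0, 0, 0), r.2)) (𝓝 (0, x))
        (𝓝 ((x, x, 1, 0, 0, 0, 0), x)) :=
      Continuous.tendsto' (by fun_prop) _ _ (by simp)
    have d1 : ∀ᶠ r : Jet k × ℂ in 𝓝 ((x, x, 1, 0, 0, 0, 0), x), ‖coeffDeriv r.2 r.1‖ < κ :=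
      c1.continuousAt.eventually_lt continuousAt_const (by simpa [coeffDeriv, P_zero] using hκ)
    have d2 : ∀ᶠ r : Jet k × ℂ in 𝓝 ((x, x, 1, 0, 0, 0, 0), x), ‖coeffValue r.2 r.1‖ < κ := by
      refine c2.continuousAt.eventually_lt continuousAt_const ?_
      have : dividedPow (k + 1) x x = (k + 1) * x ^ k := by
        unfold dividedPow
        rw [geom_sum₂_self]
        push_cast
        rfl
      simpa [coeffValue, this] using hκ
    have d3 : ∀ᶠ r : Jet k × ℂ in 𝓝 ((x, x, 1, 0, 0, 0, 0), x), ‖coeffTop r.2 r.1‖ < κ := by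
      refine c3.continuousAt.eventually_lt continuousAt_const ?_
      have : x ^ (2 * k + 1) - x ^ (k + 1) * x ^ k = 0 := by ring
      simpa [coeffTop, P_zero, this] using hκ
    have d4 : ∀ᶠ r : Jet k × ℂ in 𝓝 ((x, x, 1, 0, 0, 0, 0), x), ∀ j, ‖coeffLow j r.2 r.1‖ < κ :=
      eventually_all.2 fun j => (c4 j).continuousAt.eventually_lt continuousAt_const
        (by simpa [coeffLow] using hκ)
    filter_upwards [hm.eventually d1, hm.eventually d2, hm.eventually d3, hm.eventually d4]
      with r h1 h2 h3 h4 using ⟨h1, h2, h3, h4⟩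
  obtain ⟨δ, hδ, H⟩ := Metric.eventually_nhds_iff.1 hev
  refine ⟨δ, hδ, fun x hx q hq => ?_⟩
  have := H (y := q - (x, x, 1, 0, 0, 0, 0)) (by simpa [dist_eq_norm] using hq) x hx
  simpa using this

/-- Rigidity: two conjugacies close to the identity, from a given member of the family to members
of the family, and agreeing at the point `1`, are equal, and so are their targets. -/
theorem exists_rigidity_radius (k : ℕ) : ∃ δ > 0, ∀ (φ ψ : ℂ → ℂ) (ε h : Fin k → ℂ) (a b : ℂ),
    (∀ x ∈ closedBall (0 : ℂ) 1, AnalyticAt ℂ φ x) →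
    (∀ x ∈ closedBall (0 : ℂ) 1, AnalyticAt ℂ ψ x) →
    (∀ x ∈ sphere (0 : ℂ) 1,
      ‖((φ x, ψ x, deriv ψ x, ε, h, a, b) : Jet k) - (x, x, 1, 0, 0, 0, 0)‖ < δ) →
    (∀ x ∈ sphere (0 : ℂ) 1,
      deriv φ x * P ε x * (1 + b * φ x ^ k) = P h (φ x) * (1 + a * x ^ k)) →
    (∀ x ∈ sphere (0 : ℂ) 1,
      deriv ψ x * P ε x * (1 + a * ψ x ^ k) = P ε (ψ x) * (1 + a * x ^ k)) →
    φ 1 = ψ 1 → EqOn φ ψ (closedBall 0 1) ∧ h = ε ∧ b = a := by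
  set C : ℝ := 7 * (k + 2) ^ 2 with hC
  have hC1 : 1 ≤ C := by
    have hk0 : (0 : ℝ) ≤ k := Nat.cast_nonneg k
    rw [hC]; nlinarith
  -- The remainder has `3 + k` terms of size at most `κ * M`, and inverting the linearisation costs
  -- a factor `C`: the outcome is `M / 2`.
  set κ : ℝ := 1 / (2 * C * (k + 3)) with hκ
  have hκ0 : 0 < κ := by positivity
  obtain ⟨δ, hδ, hsmall⟩ := exists_small_coeff k hκ0
  refine ⟨δ, hδ, fun φ ψ ε h a b hφ hψ hnear hφe hψe h1 => ?_⟩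
  have hu : ∀ x ∈ closedBall (0 : ℂ) 1, AnalyticAt ℂ (fun x => φ x - ψ x) x := fun x hx =>
    (hφ x hx).sub (hψ x hx)
  have hdu : ∀ x ∈ closedBall (0 : ℂ) 1,
      deriv (fun x => φ x - ψ x) x = deriv φ x - deriv ψ x := fun x hx =>
    deriv_fun_sub (hφ x hx).differentiableAt (hψ x hx).differentiableAt
  have hstep : ∀ M : ℝ,
      ((∀ x ∈ sphere (0 : ℂ) 1, ‖φ x - ψ x‖ ≤ M ∧ ‖deriv φ x - deriv ψ x‖ ≤ M) ∧
        (∀ j, ‖h j - ε j‖ ≤ M) ∧ ‖b - a‖ ≤ M) →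
      ((∀ x ∈ sphere (0 : ℂ) 1, ‖φ x - ψ x‖ ≤ M / 2 ∧ ‖deriv φ x - deriv ψ x‖ ≤ M / 2) ∧
        (∀ j, ‖h j - ε j‖ ≤ M / 2) ∧ ‖b - a‖ ≤ M / 2) := by
    rintro M ⟨hM1, hM2, hM3⟩
    have hM0 : 0 ≤ M := (norm_nonneg _).trans hM3
    have hlin : ∀ x ∈ sphere (0 : ℂ) 1,
        ‖linearization (fun x => φ x - ψ x) (fun j => h j - ε j) (b - a) x‖
          ≤ (k + 3) * (κ * M) := by
      intro x hx
      obtain ⟨s1, s2, s3, s4⟩ := hsmall x hx _ (hnear x hx)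
      rw [linearization, hdu x (sphere_subset_closedBall hx),
        linearization_eq_remainder (hφe x hx) (hψe x hx)]
      have e : ((k : ℝ) + 3) * (κ * M) = κ * M + κ * M + κ * M + k * (κ * M) := by ring
      rw [e]
      refine (norm_add_le _ _).trans (add_le_add ((norm_add_le _ _).trans (add_le_add
        ((norm_add_le _ _).trans (add_le_add ?_ ?_)) ?_)) ?_)
      · rw [norm_mul]
        exact mul_le_mul s1.le (hM1 x hx).2 (norm_nonneg _) hκ0.le
      · rw [norm_mul]
        exact mul_le_mul s2.le (hM1 x hx).1 (norm_nonneg _) hκ0.le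
      · rw [norm_mul]
        exact mul_le_mul s3.le hM3 (norm_nonneg _) hκ0.le
      · refine (norm_sum_le _ _).trans ?_
        refine (Finset.sum_le_card_nsmul _ _ (κ * M) fun j _ => ?_).trans (by simp)
        rw [norm_mul]
        exact mul_le_mul (s4 j).le (hM2 j) (norm_nonneg _) hκ0.le
    have hCm : C * ((k + 3) * (κ * M)) = M / 2 := by
      rw [hκ]; field_simp
    have hm : (k + 3) * (κ * M) ≤ M / 2 := by
      rw [← hCm]
      exact le_mul_of_one_le_left (by positivity) hC1
    refine ⟨fun x hx => ?_, fun j => ?_, ?_⟩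
    · have := norm_le_of_linearization hu (by simp [h1]) hlin hx
      rw [hdu x (sphere_subset_closedBall hx), ← hC, hCm] at this
      exact this
    · exact (norm_coeff_le_of_linearization hu hlin j).trans hm
    · exact (norm_top_coeff_le_of_linearization hu hlin).trans hm
  obtain ⟨M₁, hM₁⟩ := (isCompact_sphere (0 : ℂ) 1).exists_bound_of_continuousOn
    (f := fun x => φ x - ψ x) fun x hx =>
      (hu x (sphere_subset_closedBall hx)).continuousAt.continuousWithinAt
  obtain ⟨M₂, hM₂⟩ := (isCompact_sphere (0 : ℂ) 1).exists_bound_of_continuousOn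
    (f := fun x => deriv φ x - deriv ψ x) fun x hx =>
      ((hφ x (sphere_subset_closedBall hx)).deriv.sub
        (hψ x (sphere_subset_closedBall hx)).deriv).continuousAt.continuousWithinAt
  -- Any finite bound starts the halving; compactness of the circle provides one.
  set M : ℝ := max (max M₁ M₂) (max ‖h - ε‖ ‖b - a‖) with hM
  have hiter : ∀ n : ℕ,
      ((∀ x ∈ sphere (0 : ℂ) 1, ‖φ x - ψ x‖ ≤ M / 2 ^ n ∧ ‖deriv φ x - deriv ψ x‖ ≤ M / 2 ^ n) ∧
        (∀ j, ‖h j - ε j‖ ≤ M / 2 ^ n) ∧ ‖b - a‖ ≤ M / 2 ^ n) := by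
    intro n
    induction n with
    | zero =>
      rw [pow_zero, div_one]
      refine ⟨fun x hx => ⟨(hM₁ x hx).trans ?_, (hM₂ x hx).trans ?_⟩,
        fun j => (norm_le_pi_norm (h - ε) j).trans ?_, ?_⟩
      · exact (le_max_left _ _).trans (le_max_left _ _)
      · exact (le_max_right _ _).trans (le_max_left _ _)
      · exact (le_max_left _ _).trans (le_max_right _ _)
      · exact (le_max_right _ _).trans (le_max_right _ _)
    | succ n ih =>
      have := hstep _ ih
      rwa [div_div, ← pow_succ] at this
  have hzero : ∀ {z : ℂ}, (∀ n : ℕ, ‖z‖ ≤ M / 2 ^ n) → z = 0 := by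
    intro z hz
    have hlim : Tendsto (fun n : ℕ => M / 2 ^ n) atTop (𝓝 0) :=
      tendsto_const_nhds.div_atTop (tendsto_pow_atTop_atTop_of_one_lt one_lt_two)
    exact norm_le_zero_iff.1 (ge_of_tendsto' hlim hz)
  refine ⟨?_, ?_, ?_⟩
  · have hd : ∀ {f : ℂ → ℂ}, (∀ x ∈ closedBall (0 : ℂ) 1, AnalyticAt ℂ f x) →
        DiffContOnCl ℂ f (ball 0 1) := fun {f} hf =>
      DifferentiableOn.diffContOnCl fun x hx => by
        rw [closure_ball _ one_ne_zero] at hx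
        exact (hf x hx).differentiableAt.differentiableWithinAt
    have := Complex.eqOn_closure_of_eqOn_frontier isBounded_ball (hd hφ) (hd hψ) (fun x hx => by
      rw [frontier_ball _ one_ne_zero] at hx
      exact sub_eq_zero.1 (hzero fun n => ((hiter n).1 x hx).1))
    rwa [closure_ball _ one_ne_zero] at this
  · funext j
    exact sub_eq_zero.1 (hzero fun n => (hiter n).2.1 j)
  · exact sub_eq_zero.1 (hzero fun n => (hiter n).2.2)

/-! ### Reduction to conjugacies close to the identity. -/

/-- The conjugacy equation with its denominators cleared. -/
theorem field_conj_iff {c d e p y p' : ℂ} {x : ℂ} {ε h : Fin k → ℂ} (hp : p = P ε x)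
    (hp' : p' = P h y) (h1 : 1 + c * x ^ k ≠ 0) (h2 : 1 + d * y ^ k ≠ 0) :
    e * field c ε x = field d h y ↔ e * p * (1 + d * y ^ k) = p' * (1 + c * x ^ k) := by
  subst hp hp'
  rw [field, field, ← mul_div_assoc, div_eq_div_iff h1 h2]

/-- The theorem for a single conjugacy close to the identity on the unit circle. -/
theorem exists_flow_of_close (k : ℕ) : ∃ (τ : ℂ × (Fin k → ℂ) × ℂ → ℂ) (δ : ℝ), 0 < δ ∧
    (∀ q, ‖q - (1, 0, 0)‖ < δ → AnalyticAt ℂ τ q) ∧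
    ∀ (φ : ℂ → ℂ) (ε h : Fin k → ℂ) (a b : ℂ), (∀ x ∈ closedBall (0 : ℂ) 1, AnalyticAt ℂ φ x) →
      (∀ x ∈ closedBall (0 : ℂ) 1, ‖φ x - x‖ < δ) → ‖ε‖ < δ → ‖h‖ < δ → ‖a‖ < δ → ‖b‖ < δ →
      (∀ x ∈ closedBall (0 : ℂ) 1,
        deriv φ x * P ε x * (1 + b * φ x ^ k) = P h (φ x) * (1 + a * x ^ k)) →
      h = ε ∧ b = a ∧ ∀ x ∈ closedBall (0 : ℂ) 1,
        FlowsTo (fieldDomain k a) (field a ε) (τ (φ 1, ε, a)) x (φ x) := by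
  obtain ⟨δ₁, hδ₁, hrig⟩ := exists_rigidity_radius k
  obtain ⟨τ, hτa, hτ0, hτ⟩ := exists_transit_time k
  have hlim : Tendsto (fun q : ℂ × (Fin k → ℂ) × ℂ => (τ q, q.2.1, q.2.2)) (𝓝 (1, 0, 0))
      (𝓝 (0, 0, 0)) := by
    have : ContinuousAt (fun q : ℂ × (Fin k → ℂ) × ℂ => (τ q, q.2.1, q.2.2)) (1, 0, 0) := by
      have := hτa.continuousAt
      fun_prop
    simpa [ContinuousAt, hτ0] using this
  obtain ⟨δ₂, hδ₂, H⟩ := Metric.eventually_nhds_iff.1 ((hτa.eventually_analyticAt.and hτ).and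
    (hlim.eventually (eventually_flowMap_close hδ₁)))
  refine ⟨τ, min δ₁ δ₂, lt_min hδ₁ hδ₂, fun q hq => ?_, ?_⟩
  · exact (H (y := q) (by rw [dist_eq_norm]; exact hq.trans_le (min_le_right _ _))).1.1
  · intro φ ε h a b hφ hφx hε hh ha hb heq
    obtain ⟨⟨-, hq1⟩, hq2⟩ := H (y := (φ 1, ε, a)) (by
      rw [dist_eq_norm]
      refine lt_of_lt_of_le ?_ (min_le_right δ₁ δ₂)
      simp only [Prod.mk_sub_mk, sub_zero, Prod.norm_def]
      exact max_lt (hφx 1 (by simp)) (max_lt hε ha))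
    -- The time at which the source field flows `1` to `φ 1`, so that `ψ` agrees with `φ` at `1`.
    set t := τ (φ 1, ε, a) with ht
    set ψ : ℂ → ℂ := fun z => flowMap (t, ε, a, z) with hψ
    obtain ⟨hEq, hhε, hba⟩ := hrig φ ψ ε h a b hφ (fun x hx => (hq2 x hx).1) (fun x hx => by
        have hx' := sphere_subset_closedBall hx
        simp only [Prod.mk_sub_mk, sub_zero, Prod.norm_def]
        refine max_lt ((hφx x hx').trans_le (min_le_left _ _)) (max_lt (hq2 x hx').2.2.1
          (max_lt (hq2 x hx').2.2.2 (max_lt (hε.trans_le (min_le_left _ _))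
          (max_lt (hh.trans_le (min_le_left _ _)) (max_lt (ha.trans_le (min_le_left _ _))
          (hb.trans_le (min_le_left _ _))))))))
      (fun x hx => heq x (sphere_subset_closedBall hx)) (fun x hx => by
        obtain ⟨h1, h2, -, -⟩ := hq2 x (sphere_subset_closedBall hx)
        have key := deriv_mul_eq_of_flowsTo (isOpen_fieldDomain k a) (differentiableOn_field a ε)
          h1.differentiableAt h2
        exact (field_conj_iff rfl rfl h2.self_of_nhds.left_mem h2.self_of_nhds.right_mem).1 key)
      hq1.symm
    refine ⟨hhε, hba, fun x hx => ?_⟩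
    rw [hEq hx]
    exact (hq2 x hx).2.1.self_of_nhds

/-- Since `h` does not depend on `x`, the `x`-derivative of the change at the origin is `(φ_0'(0),
0)`, and the left inverse `Θ` forbids it to vanish. -/
theorem deriv_ne_zero_of_isAnalyticChange {φ : (Fin k → ℂ) → ℂ → ℂ}
    {h : (Fin k → ℂ) → (Fin k → ℂ)}
    (hΨ : IsAnalyticChange (fun p : ℂ × (Fin k → ℂ) => (φ p.2 p.1, h p.2))) :
    deriv (φ 0) 0 ≠ 0 := by
  obtain ⟨ha, h0, Θ, hΘa, hΘ0, hΘ, -⟩ := hΨ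
  have hφ : AnalyticAt ℂ (fun p : ℂ × (Fin k → ℂ) => φ p.2 p.1) 0 := analyticAt_fst.comp ha
  have hd : DifferentiableAt ℂ (φ 0) 0 := (eventually_differentiableAt_slice hφ).self_of_nhds
  intro hl
  have h1 : HasDerivAt (fun x => ((φ 0 x, h 0) : ℂ × (Fin k → ℂ))) (0, 0) 0 := by
    have := hd.hasDerivAt
    rw [hl] at this
    exact this.prodMk (hasDerivAt_const _ _)
  have h2 : HasFDerivAt Θ (fderiv ℂ Θ 0) ((φ 0 0, h 0) : ℂ × (Fin k → ℂ)) := by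
    have e : ((φ 0 0, h 0) : ℂ × (Fin k → ℂ)) = 0 := h0
    rw [e]
    exact hΘa.differentiableAt.hasFDerivAt
  have h3 := h2.comp_hasDerivAt (0 : ℂ) h1
  have h4 : HasDerivAt (fun x : ℂ => ((x, 0) : ℂ × (Fin k → ℂ))) (1, 0) 0 :=
    (hasDerivAt_id _).prodMk (hasDerivAt_const _ _)
  have hline : Tendsto (fun x : ℂ => ((x, 0) : ℂ × (Fin k → ℂ))) (𝓝 0) (𝓝 0) :=
    Continuous.tendsto' (by fun_prop) _ _ rfl
  have h5 := h3.congr_of_eventuallyEq (f₁ := fun x : ℂ => ((x, 0) : ℂ × (Fin k → ℂ))) (by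
    filter_upwards [hline.eventually hΘ] with x hx using hx.symm)
  have h6 := congrArg Prod.fst (h4.unique h5)
  have e0 : ((0, 0) : ℂ × (Fin k → ℂ)) = 0 := rfl
  rw [e0, map_zero] at h6
  exact one_ne_zero h6

/-- A conjugacy between two members of the family with a multiple zero at the origin has a root of
unity as its multiplier. -/
theorem deriv_pow_eq_one (hk : 1 ≤ k) {φ : ℂ → ℂ} (hφ : AnalyticAt ℂ φ 0) (h0 : φ 0 = 0)
    (hne : deriv φ 0 ≠ 0) {a b : ℂ}
    (heq : ∀ᶠ x in 𝓝 0, deriv φ x * x ^ (k + 1) * (1 + b * φ x ^ k)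
      = φ x ^ (k + 1) * (1 + a * x ^ k)) : deriv φ 0 ^ k = 1 := by
  have hk0 : k ≠ 0 := by omega
  have hslope : Tendsto (fun x => φ x / x) (𝓝[≠] 0) (𝓝 (deriv φ 0)) := by
    have := hφ.differentiableAt.hasDerivAt.tendsto_slope
    refine this.congr fun x => ?_
    simp [slope, h0, div_eq_inv_mul]
  have hL : Tendsto (fun x => deriv φ x * (1 + b * φ x ^ k)) (𝓝[≠] 0) (𝓝 (deriv φ 0)) := by
    have hc : ContinuousAt (fun x => deriv φ x * (1 + b * φ x ^ k)) 0 := by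
      have h1 := hφ.continuousAt
      have h2 := hφ.deriv.continuousAt
      fun_prop
    have := hc.tendsto.mono_left (nhdsWithin_le_nhds (s := {0}ᶜ))
    simpa [h0, hk0] using this
  have hR : Tendsto (fun x => (φ x / x) ^ (k + 1) * (1 + a * x ^ k)) (𝓝[≠] 0)
      (𝓝 (deriv φ 0 ^ (k + 1))) := by
    have hc : Tendsto (fun x : ℂ => 1 + a * x ^ k) (𝓝[≠] 0) (𝓝 1) := by
      refine (Continuous.tendsto' (by fun_prop) _ _ ?_).mono_left nhdsWithin_le_nhds
      simp [hk0]
    simpa using (hslope.pow (k + 1)).mul hc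
  -- Divided by `x ^ (k + 1)`, the equation tends to `l = l ^ (k + 1)` with `l = deriv φ 0`.
  have heq' : (fun x => deriv φ x * (1 + b * φ x ^ k)) =ᶠ[𝓝[≠] 0]
      fun x => (φ x / x) ^ (k + 1) * (1 + a * x ^ k) := by
    filter_upwards [nhdsWithin_le_nhds heq, self_mem_nhdsWithin] with x hx hx0
    have hx0' : x ≠ 0 := hx0
    rw [div_pow]
    field_simp
    linear_combination hx
  have := tendsto_nhds_unique (hL.congr' heq') hR
  rw [pow_succ] at this
  exact mul_right_cancel₀ hne (by rw [one_mul]; exact this.symm)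

theorem scale_inv_scale {s : ℂ} (hs : s ≠ 0) (ε : Fin k → ℂ) :
    (fun j : Fin k => s ^ (k + 1 - (j : ℕ)) * ((s ^ (k + 1 - (j : ℕ)))⁻¹ * ε j)) = ε := by
  funext j
  rw [mul_inv_cancel_left₀ (pow_ne_zero _ hs)]

/-- Scales at which a function with nonzero derivative is close to its linear part. -/
theorem eventually_rescale_close {f : ℂ → ℂ} (hf : DifferentiableAt ℂ f 0) (h0 : f 0 = 0)
    (hne : deriv f 0 ≠ 0) {δ : ℝ} (hδ : 0 < δ) :
    ∀ᶠ r : ℂ in 𝓝[≠] 0, ∀ x ∈ closedBall (0 : ℂ) 1,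
      ‖(deriv f 0 * r)⁻¹ * f (r * x) - x‖ < δ := by
  have hO := (hasDerivAt_iff_isLittleO.1 hf.hasDerivAt).def
    (c := δ / 2 * ‖deriv f 0‖) (by have := norm_pos_iff.2 hne; positivity)
  obtain ⟨ρ, hρ, H⟩ := Metric.eventually_nhds_iff.1 hO
  filter_upwards [nhdsWithin_le_nhds (ball_mem_nhds (0 : ℂ) hρ), self_mem_nhdsWithin]
    with r hr hr0 x hx
  have hr0' : r ≠ 0 := hr0
  have hx1 : ‖x‖ ≤ 1 := by simpa using hx
  have hrρ : ‖r‖ < ρ := by simpa using hr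
  have hrx : ‖r * x‖ ≤ ‖r‖ := by
    rw [norm_mul]; exact mul_le_of_le_one_right (norm_nonneg _) hx1
  have h1 := H (y := r * x) (by simpa [dist_eq_norm] using hrx.trans_lt hrρ)
  simp only [h0, sub_zero, smul_eq_mul] at h1
  have e : (deriv f 0 * r)⁻¹ * f (r * x) - x
      = (deriv f 0 * r)⁻¹ * (f (r * x) - r * x * deriv f 0) := by
    field_simp
  have hl : 0 < ‖deriv f 0‖ := norm_pos_iff.2 hne
  have hr' : 0 < ‖r‖ := norm_pos_iff.2 hr0'
  rw [e, norm_mul, norm_inv, norm_mul]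
  calc (‖deriv f 0‖ * ‖r‖)⁻¹ * ‖f (r * x) - r * x * deriv f 0‖
      ≤ (‖deriv f 0‖ * ‖r‖)⁻¹ * (δ / 2 * ‖deriv f 0‖ * ‖r‖) := by
        gcongr
        exact h1.trans (by gcongr)
    _ = δ / 2 := by field_simp
    _ < δ := by linarith

theorem exists_flowsTo_of_conjugateUnder (hk : 1 ≤ k) {a a' : (Fin k → ℂ) → ℂ}
    (ha : AnalyticAt ℂ a 0) (ha' : AnalyticAt ℂ a' 0)
    {φ : (Fin k → ℂ) → ℂ → ℂ} {h : (Fin k → ℂ) → (Fin k → ℂ)}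
    (hΨ : IsAnalyticChange (fun p : ℂ × (Fin k → ℂ) => (φ p.2 p.1, h p.2)))
    (hconj : ConjugateUnder (fun ε => field (a ε) ε) (fun η => field (a' η) η) φ h) :
    ∃ (l : ℂ) (T : (Fin k → ℂ) → ℂ), l ^ k = 1 ∧ AnalyticAt ℂ T 0 ∧
      (∀ᶠ p : ℂ × (Fin k → ℂ) in 𝓝 0, FlowsTo (fieldDomain k (a' (h p.2)))
        (field (a' (h p.2)) (h p.2)) (T p.2) (l * p.1) (φ p.2 p.1)) ∧
      (∀ᶠ ε : Fin k → ℂ in 𝓝 0, ∀ j : Fin k, ε j = l ^ ((j : ℤ) - 1) * h ε j) ∧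
      (∀ᶠ ε : Fin k → ℂ in 𝓝 0, a ε = a' (h ε)) := by
  have hk0 : k ≠ 0 := by omega
  have hΨa := hΨ.1
  have hφ : AnalyticAt ℂ (fun p : ℂ × (Fin k → ℂ) => φ p.2 p.1) 0 := analyticAt_fst.comp hΨa
  have hφ0 : φ 0 0 = 0 := congrArg Prod.fst hΨ.2.1
  have hh0 : h 0 = 0 := congrArg Prod.snd hΨ.2.1
  have hh : AnalyticAt ℂ h 0 := by
    have h1 : AnalyticAt ℂ (fun p : ℂ × (Fin k → ℂ) => h p.2) 0 := analyticAt_snd.comp hΨa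
    have h2 : AnalyticAt ℂ (fun ε : Fin k → ℂ => ((0, ε) : ℂ × (Fin k → ℂ))) 0 := by fun_prop
    exact AnalyticAt.comp (f := fun ε : Fin k → ℂ => ((0, ε) : ℂ × (Fin k → ℂ))) h1 h2
  have hb : AnalyticAt ℂ (fun ε => a' (h ε)) 0 :=
    AnalyticAt.comp (f := h) (by rw [hh0]; exact ha') hh
  have hsnd : Tendsto (Prod.snd : ℂ × (Fin k → ℂ) → _) (𝓝 0) (𝓝 0) :=
    continuous_snd.tendsto' _ _ rfl
  -- the equation without denominators
  have heq : ∀ᶠ p : ℂ × (Fin k → ℂ) in 𝓝 0,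
      deriv (φ p.2) p.1 * P p.2 p.1 * (1 + a' (h p.2) * φ p.2 p.1 ^ k)
        = P (h p.2) (φ p.2 p.1) * (1 + a p.2 * p.1 ^ k) := by
    have c1 : ContinuousAt (fun p : ℂ × (Fin k → ℂ) => 1 + a p.2 * p.1 ^ k) 0 := by
      have : ContinuousAt (fun p : ℂ × (Fin k → ℂ) => a p.2) 0 :=
        ContinuousAt.comp (g := a) (f := Prod.snd) (x := (0 : ℂ × (Fin k → ℂ))) ha.continuousAt
          continuousAt_snd
      fun_prop
    have c2 : ContinuousAt (fun p : ℂ × (Fin k → ℂ) => 1 + a' (h p.2) * φ p.2 p.1 ^ k) 0 := by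
      have h1 : ContinuousAt (fun p : ℂ × (Fin k → ℂ) => a' (h p.2)) 0 :=
        ContinuousAt.comp (g := fun ε => a' (h ε)) (f := Prod.snd) (x := (0 : ℂ × (Fin k → ℂ)))
          hb.continuousAt continuousAt_snd
      exact continuousAt_const.add (h1.mul (hφ.continuousAt.pow k))
    filter_upwards [hconj, (c1.eventually_ne (by simp [hk0]) : ∀ᶠ p : ℂ × (Fin k → ℂ) in 𝓝 0,
        1 + a p.2 * p.1 ^ k ≠ 0),
      (c2.eventually_ne (by simp [hφ0, hk0]) : ∀ᶠ p : ℂ × (Fin k → ℂ) in 𝓝 0,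
        1 + a' (h p.2) * φ p.2 p.1 ^ k ≠ 0)] with p hp h1 h2
    exact (field_conj_iff rfl rfl h1 h2).1 hp
  set l : ℂ := deriv (φ 0) 0 with hl
  have hl0 : l ≠ 0 := deriv_ne_zero_of_isAnalyticChange hΨ
  have hline : Tendsto (fun x : ℂ => ((x, 0) : ℂ × (Fin k → ℂ))) (𝓝 0) (𝓝 0) :=
    Continuous.tendsto' (by fun_prop) _ _ rfl
  have hφ00 : AnalyticAt ℂ (φ 0) 0 := by
    have : AnalyticAt ℂ (fun x : ℂ => ((x, 0) : ℂ × (Fin k → ℂ))) 0 := by fun_prop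
    exact AnalyticAt.comp (f := fun x : ℂ => ((x, 0) : ℂ × (Fin k → ℂ))) hφ this
  have hlk : l ^ k = 1 := by
    refine deriv_pow_eq_one hk hφ00 hφ0 hl0 (a := a 0) (b := a' (h 0)) ?_
    filter_upwards [hline.eventually heq] with x hx
    simpa only [hh0, P_zero] using hx
  obtain ⟨τ, δ, hδ, hτ, hmain⟩ := exists_flow_of_close k
  -- choice of the scale
  obtain ⟨r, hr0, hrclose, hrgood, hra, hrb⟩ : ∃ r : ℂ, r ≠ 0 ∧
      (∀ x ∈ closedBall (0 : ℂ) 1, ‖(l * r)⁻¹ * φ 0 (r * x) - x‖ < δ) ∧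
      (∀ x ∈ closedBall (0 : ℂ) 1,
        AnalyticAt ℂ (fun p : ℂ × (Fin k → ℂ) => φ p.2 p.1) (r * x, 0) ∧
        ∀ᶠ p : ℂ × (Fin k → ℂ) in 𝓝 (r * x, 0),
          deriv (φ p.2) p.1 * P p.2 p.1 * (1 + a' (h p.2) * φ p.2 p.1 ^ k)
            = P (h p.2) (φ p.2 p.1) * (1 + a p.2 * p.1 ^ k)) ∧
      ‖a 0 * r ^ k‖ < δ ∧ ‖a' 0 * r ^ k‖ < δ := by
    have hsmall : ∀ c : ℂ, ∀ᶠ r : ℂ in 𝓝[≠] 0, ‖c * r ^ k‖ < δ := fun c =>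
      nhdsWithin_le_nhds ((by fun_prop : Continuous fun r : ℂ => ‖c * r ^ k‖).continuousAt.eventually_lt
        continuousAt_const (by simpa [hk0] using hδ))
    obtain ⟨ρ, hρ, hgood⟩ := Metric.eventually_nhds_iff.1
      (hline.eventually (hφ.eventually_analyticAt.and heq.eventually_nhds))
    have hball : ∀ᶠ r : ℂ in 𝓝[≠] 0, r ∈ ball (0 : ℂ) ρ :=
      nhdsWithin_le_nhds (ball_mem_nhds 0 hρ)
    obtain ⟨r, ⟨⟨⟨h1, h2⟩, h3⟩, h4⟩, h5⟩ :=
      ((((eventually_rescale_close hφ00.differentiableAt hφ0 hl0 hδ).and hball).and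
        (hsmall (a 0))).and (hsmall (a' 0)) |>.and self_mem_nhdsWithin).exists
    refine ⟨r, h5, h1, fun x hx => hgood ?_, h3, h4⟩
    have hx1 : ‖x‖ ≤ 1 := by simpa using hx
    have hrρ : ‖r‖ < ρ := by simpa using h2
    rw [dist_eq_norm, sub_zero, norm_mul]
    exact (mul_le_of_le_one_right (norm_nonneg _) hx1).trans_lt hrρ
  have hs0 : l * r ≠ 0 := mul_ne_zero hl0 hr0
  -- Hence the source dilation `r` and the target dilation `l * r` multiply `a` and `a'` by the same
  -- factor.
  have hsk : (l * r) ^ k = r ^ k := by rw [mul_pow, hlk, one_mul]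
  -- the rescaled data
  set εs : (Fin k → ℂ) → Fin k → ℂ := fun ε j => (r ^ (k + 1 - (j : ℕ)))⁻¹ * ε j with hεs
  set hs : (Fin k → ℂ) → Fin k → ℂ := fun ε j => ((l * r) ^ (k + 1 - (j : ℕ)))⁻¹ * h ε j with hhs
  set φs : (Fin k → ℂ) → ℂ → ℂ := fun ε x => (l * r)⁻¹ * φ ε (r * x) with hφs
  have hεsa : AnalyticAt ℂ εs 0 := by
    refine analyticAt_pi_iff.2 fun j => ?_
    have : AnalyticAt ℂ (fun ε : Fin k → ℂ => ε j) 0 :=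
      (ContinuousLinearMap.proj (R := ℂ) (φ := fun _ : Fin k => ℂ) j).analyticAt 0
    exact analyticAt_const.mul this
  have hhsc : ContinuousAt hs 0 := by
    refine continuousAt_pi.2 fun j => ?_
    exact continuousAt_const.mul ((continuous_apply j).continuousAt.comp hh.continuousAt)
  have hεs0 : εs 0 = 0 := by funext j; simp [hεs]
  have hhs0 : hs 0 = 0 := by funext j; simp [hhs, hh0]
  have hφs1 : AnalyticAt ℂ (fun ε => φs ε 1) 0 := by
    have h1 : AnalyticAt ℂ (fun ε : Fin k → ℂ => ((r * 1, ε) : ℂ × (Fin k → ℂ))) 0 := by fun_prop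
    have h2 := (hrgood 1 (by simp)).1
    exact analyticAt_const.mul
      (AnalyticAt.comp (f := fun ε : Fin k → ℂ => ((r * 1, ε) : ℂ × (Fin k → ℂ))) h2 h1)
  have hconcl : ∀ᶠ ε : Fin k → ℂ in 𝓝 0, hs ε = εs ε ∧ a' (h ε) * r ^ k = a ε * r ^ k ∧
      ∀ x ∈ closedBall (0 : ℂ) 1, FlowsTo (fieldDomain k (a ε * r ^ k))
        (field (a ε * r ^ k) (εs ε)) (τ (φs ε 1, εs ε, a ε * r ^ k)) x (φs ε x) := by
    have e1 : ∀ᶠ ε : Fin k → ℂ in 𝓝 0, ‖εs ε‖ < δ :=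
      hεsa.continuousAt.norm.eventually_lt continuousAt_const (by simpa [hεs0] using hδ)
    have e2 : ∀ᶠ ε : Fin k → ℂ in 𝓝 0, ‖hs ε‖ < δ :=
      hhsc.norm.eventually_lt continuousAt_const (by simpa [hhs0] using hδ)
    have e3 : ∀ᶠ ε : Fin k → ℂ in 𝓝 0, ‖a ε * r ^ k‖ < δ :=
      (ha.continuousAt.mul continuousAt_const).norm.eventually_lt continuousAt_const hra
    have e4 : ∀ᶠ ε : Fin k → ℂ in 𝓝 0, ‖a' (h ε) * r ^ k‖ < δ := by
      refine (hb.continuousAt.mul continuousAt_const).norm.eventually_lt continuousAt_const ?_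
      rw [← hh0] at hrb
      exact hrb
    have e5 : ∀ᶠ ε : Fin k → ℂ in 𝓝 0, ∀ x ∈ closedBall (0 : ℂ) 1,
        AnalyticAt ℂ (fun p : ℂ × (Fin k → ℂ) => φ p.2 p.1) (r * x, ε) ∧
        deriv (φ ε) (r * x) * P ε (r * x) * (1 + a' (h ε) * φ ε (r * x) ^ k)
            = P (h ε) (φ ε (r * x)) * (1 + a ε * (r * x) ^ k) ∧ ‖φs ε x - x‖ < δ := by
      refine (isCompact_closedBall (0 : ℂ) 1).eventually_forall_of_forall_eventually fun x hx => ?_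
      have hm : Tendsto (fun q : (Fin k → ℂ) × ℂ => ((r * q.2, q.1) : ℂ × (Fin k → ℂ)))
          (𝓝 (0, x)) (𝓝 (r * x, 0)) := Continuous.tendsto' (by fun_prop) _ _ rfl
      obtain ⟨g1, g2⟩ := hrgood x hx
      have c : ContinuousAt (fun q : (Fin k → ℂ) × ℂ => ‖φs q.1 q.2 - q.2‖) (0, x) := by
        have c1 : ContinuousAt (fun q : (Fin k → ℂ) × ℂ => φ q.1 (r * q.2)) (0, x) :=
          ContinuousAt.comp (g := fun p : ℂ × (Fin k → ℂ) => φ p.2 p.1)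
            (f := fun q : (Fin k → ℂ) × ℂ => ((r * q.2, q.1) : ℂ × (Fin k → ℂ)))
            g1.continuousAt hm
        exact ((continuousAt_const.mul c1).sub continuousAt_snd).norm
      filter_upwards [hm.eventually g1.eventually_analyticAt, hm.eventually g2,
        c.eventually_lt continuousAt_const (hrclose x hx)] with q q1 q2 q3 using ⟨q1, q2, q3⟩
    filter_upwards [e1, e2, e3, e4, e5] with ε f1 f2 f3 f4 f5
    have hφan : ∀ x ∈ closedBall (0 : ℂ) 1, AnalyticAt ℂ (φ ε) (r * x) := fun x hx => by
      have h1 : AnalyticAt ℂ (fun z : ℂ => ((z, ε) : ℂ × (Fin k → ℂ))) (r * x) := by fun_prop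
      exact AnalyticAt.comp (f := fun z : ℂ => ((z, ε) : ℂ × (Fin k → ℂ))) (f5 x hx).1 h1
    have hmul : ∀ x : ℂ, AnalyticAt ℂ (fun z : ℂ => r * z) x := fun x => by fun_prop
    refine hmain (φs ε) (εs ε) (hs ε) (a ε * r ^ k) (a' (h ε) * r ^ k)
      (fun x hx => analyticAt_const.mul
        (AnalyticAt.comp (f := fun z : ℂ => r * z) (hφan x hx) (hmul x)))
      (fun x hx => (f5 x hx).2.2) f1 f2 f3 f4 fun x hx => ?_
    have hd : deriv (φs ε) x = l⁻¹ * deriv (φ ε) (r * x) := by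
      have h1 : HasDerivAt (fun z : ℂ => r * z) r x := by
        simpa using (hasDerivAt_id x).const_mul r
      have h2 := ((hφan x hx).differentiableAt.hasDerivAt.comp x h1).const_mul (l * r)⁻¹
      rw [show l⁻¹ * deriv (φ ε) (r * x) = (l * r)⁻¹ * (deriv (φ ε) (r * x) * r) by field_simp]
      exact h2.deriv
    have hP1 : P ε (r * x) = r ^ (k + 1) * P (εs ε) x := by
      rw [← P_scale r, hεs]
      simp only [scale_inv_scale hr0]
    have hφe : φ ε (r * x) = l * r * φs ε x := by
      simp only [hφs]
      rw [mul_inv_cancel_left₀ hs0]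
    have hP2 : P (h ε) (φ ε (r * x)) = l * r ^ (k + 1) * P (hs ε) (φs ε x) := by
      have : l * r ^ (k + 1) = (l * r) ^ (k + 1) := by rw [pow_succ, pow_succ, hsk]; ring
      rw [this, ← P_scale (l * r), hhs, hφe]
      simp only [scale_inv_scale hs0]
    have key := (f5 x hx).2.1
    rw [hP1, hP2, hφe, mul_pow (l * r), hsk, mul_pow r] at key
    rw [hd]
    have hrk : r ^ (k + 1) ≠ 0 := pow_ne_zero _ hr0
    refine mul_left_cancel₀ (mul_ne_zero hl0 hrk) ?_
    have hll : l * l⁻¹ = 1 := mul_inv_cancel₀ hl0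
    linear_combination key + (r ^ (k + 1) * deriv (φ ε) (r * x) * P (εs ε) x
      * (1 + a' (h ε) * r ^ k * φs ε x ^ k)) * hll
  -- The quotient by `(l * r) ^ k` is the change of time under the target dilation.
  refine ⟨l, fun ε => τ (φs ε 1, εs ε, a ε * r ^ k) / (l * r) ^ k, hlk, ?_, ?_, ?_, ?_⟩
  · have h1 : AnalyticAt ℂ (fun ε => (φs ε 1, εs ε, a ε * r ^ k)) 0 :=
      hφs1.prod (hεsa.prod (ha.mul analyticAt_const))
    have h2 : AnalyticAt ℂ τ (φs 0 1, εs 0, a 0 * r ^ k) := by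
      refine hτ _ ?_
      simp only [Prod.mk_sub_mk, sub_zero, Prod.norm_def]
      exact max_lt (hrclose 1 (by simp)) (max_lt (by simpa [hεs0] using hδ) hra)
    have h3 := AnalyticAt.comp (f := fun ε => (φs ε 1, εs ε, a ε * r ^ k)) h2 h1
    exact h3.div analyticAt_const (pow_ne_zero _ hs0)
  · have hball : ∀ᶠ p : ℂ × (Fin k → ℂ) in 𝓝 0, ‖r⁻¹ * p.1‖ < 1 :=
      (by fun_prop : Continuous fun p : ℂ × (Fin k → ℂ) => ‖r⁻¹ * p.1‖).continuousAt.eventually_lt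
        continuousAt_const (by simp)
    filter_upwards [hsnd.eventually hconcl, hball] with p ⟨p1, p2, p3⟩ hp
    have hf := p3 (r⁻¹ * p.1) (by simpa using hp.le)
    rw [← p2, ← hsk] at hf
    have hf2 := hf.scale hs0
    -- As the rescaled source and target parameters coincide, undoing the dilation with `l * r`
    -- instead of `r` yields the flow of the target field, starting from `l * p.1`.
    have e1 : (fun j : Fin k => (l * r) ^ (k + 1 - (j : ℕ)) * εs p.2 j) = h p.2 := by
      rw [← p1]
      exact scale_inv_scale hs0 _
    have e2 : l * r * (r⁻¹ * p.1) = l * p.1 := by field_simp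
    have e3 : l * r * φs p.2 (r⁻¹ * p.1) = φ p.2 p.1 := by
      simp only [hφs]
      rw [mul_inv_cancel_left₀ hs0, mul_inv_cancel_left₀ hr0]
    rw [e1, e2, e3, hsk, p2] at hf2
    rw [hsk]
    exact hf2
  · filter_upwards [hconcl] with ε ⟨h1, _, _⟩ j
    have hj := congrFun h1 j
    simp only [hhs, hεs] at hj
    have hlj : l ^ (k + 1 - (j : ℕ)) ≠ 0 := pow_ne_zero _ hl0
    have hrj : r ^ (k + 1 - (j : ℕ)) ≠ 0 := pow_ne_zero _ hr0
    have h2 : h ε j = l ^ (k + 1 - (j : ℕ)) * ε j := by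
      rw [mul_pow] at hj
      field_simp at hj
      exact hj
    rw [h2, ← mul_assoc, mul_comm (l ^ (((j : ℕ) : ℤ) - 1)), zpow_sub_one_mul_pow hl0 hlk, one_mul]
  · filter_upwards [hconcl] with ε ⟨_, h2, _⟩
    exact (mul_right_cancel₀ (pow_ne_zero _ hr0) h2).symm

end OneDimFamily

theorem theorem3p5 (k : ℕ) (hk : 1 ≤ k)
    (a a' : (Fin k → ℂ) → ℂ) (ha : AnalyticAt ℂ a 0) (ha' : AnalyticAt ℂ a' 0)
    (φ : (Fin k → ℂ) → ℂ → ℂ) (h : (Fin k → ℂ) → (Fin k → ℂ))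
    (hΨ : OneDimFamily.IsAnalyticChange
      (fun p : ℂ × (Fin k → ℂ) => (φ p.2 p.1, h p.2))) :
    OneDimFamily.ConjugateUnder
        (fun ε => OneDimFamily.field (a ε) ε) (fun η => OneDimFamily.field (a' η) η) φ h ↔
      ∃ (l : ℂ) (T : (Fin k → ℂ) → ℂ), l ^ k = 1 ∧ AnalyticAt ℂ T 0 ∧
        (∀ᶠ p : ℂ × (Fin k → ℂ) in 𝓝 0,
          OneDimFamily.FlowsTo (OneDimFamily.fieldDomain k (a' (h p.2)))
            (OneDimFamily.field (a' (h p.2)) (h p.2)) (T p.2) (l * p.1) (φ p.2 p.1)) ∧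
        (∀ᶠ ε : Fin k → ℂ in 𝓝 0, ∀ j : Fin k, ε j = l ^ ((j : ℤ) - 1) * h ε j) ∧
        (∀ᶠ ε : Fin k → ℂ in 𝓝 0, a ε = a' (h ε)) := by
  refine ⟨OneDimFamily.exists_flowsTo_of_conjugateUnder hk ha ha' hΨ, ?_⟩
  rintro ⟨l, T, hlk, -, hfl, hε, haε⟩
  exact OneDimFamily.conjugateUnder_of_flowsTo hk hlk (analyticAt_fst.comp hΨ.1) hfl hε haε
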